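/- **Setting.** Let $(X,d)$ be a compact metric space and let $v$ be a flow on $X$, i.e. a continuous action $(x,t)\mapsto x\cdot t$ of $\mathbb R$ on $X$. For $S\subseteq X$ and $r>0$ let $B_r(S)$ be the closed $r$-neighbourhood of $S$. *Cocycles.* A continuous 1-cocycle $\alpha$ is a bounded function $\alpha:X\times X\to\mathbb R$ that is continuous near the diagonal and satisfies $\alpha(y,z)-\alpha(x,z)+\alpha(x,y)=0$ whenever $x,y,z$ are sufficiently close to each other. For $S\subseteq X$, a continuous $\beta:S\to\mathbb R$ is a primitive of $\alpha$ on $S$ if $\alpha(x,y)=\beta(y)-\beta(x)$ for all sufficiently close $x,y\in S$; $\alpha$ is *trivial* if it has a primitive on $X$, and *nontrivial* otherwise. For a curve $\gamma:[a,b]\to X$, $\int_\gamma\alpha$ is the common value of $\sum_k\alpha(\gamma(t_k),\gamma(t_{k+1}))$ over all sufficiently fine partitions $a=t_0\le\dots\le t_m=b$. *$\alpha$-flows.* A closed set $N$ is an isolating neighbourhood of $A\subseteq \operatorname{int}N$ if $A=\{x: x\cdot\mathbb R\subseteq N\}$; $A$ is an isolated invariant set if it is closed and has an isolating neighbourhood.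 For a neighbourhood $V$ of $A$, the flow neighbourhood $A(V,r)$ is the set of all $x$ for which there is $t\in\mathbb R$ such that $x\cdot t\in B_r(A)$ and $x\cdot u\in V$ for all $u$ between $0$ and $t$. The flow $v$ is an *$\alpha$-flow* if $\alpha$ is a continuous 1-cocycle and there are finitely many (possibly no) distinct points $p_1,\dots,p_n$ forming an isolated invariant set that contains all fixed points of $v$, pairwise disjoint closed isolating neighbourhoods $V_i$ of $\{p_i\}$, and numbers $r,T_0,\rho>0$, $0\le\lambda<1$ with $B_r(p_i)\subseteq V_i$ such that, with $K_i=\{p_i\}(V_i,r)$ and $K=\bigcup_iK_i$: 1. on each $K_i$, $\alpha$ has a primitive $\beta_i$ with $|\beta_i(y)-\beta_i(x)|\le\lambda\rho$ for all $x,y\in K_i$; 2. $\int_{[x\cdot a,\,x\cdot b]}\alpha\ge\rho$ whenever $a<b$, $x\cdot a,\,x\cdot b\in K$ and $x\cdot t\notin K$ for all $t\in(a,b)$; 3. $\int_{[x\cdot a,\,x\cdot(a+T_0)]}\alpha\ge\rho$ whenever $x\cdot t\notin K$ for all $t\ge a$, or $x\cdot t\notin K$ for all $t\le a+T_0$. *Gradient-like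 flows.* The flow $v$ is gradient-like if there is a continuous $g:X\to\mathbb R$ such that $t\mapsto g(x\cdot t)$ is strictly decreasing for every $x$ that is not a fixed point. *Chains.* Let $\mathcal U(s)$ be a covering of $X$ by open balls of radius $s>0$. A $(\mathcal U(s),T)$-chain is a sequence $\tilde\gamma=\{x_1,\dots,x_{m+1}\mid t_1,\dots,t_m\}$, $m\ge1$, of points of $X$ and times $t_k\ge T$ such that for each $k$ the points $x_k\cdot t_k$ and $x_{k+1}$ lie in a common ball of $\mathcal U(s)$. Its $\alpha$-integral is $$\int_{\tilde\gamma}\alpha=\sum_{k=1}^m\Big(\int_{[x_k,\,x_k\cdot t_k]}\alpha+\alpha(x_k\cdot t_k,\,x_{k+1})\Big).$$ **Theorem 3.4.** Let $v$ be an $\alpha$-flow on the compact metric space $(X,d)$ with a nontrivial cocycle $\alpha$. If $v$ is not gradient-like, then for every sequence of positive numbers $s_i\to0$, all coverings $\mathcal U(s_i)$ of $X$ by open balls of radius $s_i$, all $M,T>0$ and every $i$, there is a $(\mathcal U(s_i),T)$-chain $\tilde\gamma_i$ with $$\Big|\int_{\tilde\gamma_i}\alpha\Big|\ge M .$$ 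-/

import Mathlib

open Set Filter Topology

namespace CocycleFlow

/-! ### Continuous 1-cocycles and their integrals -/

section Cocycles

set_option linter.unusedSectionVars false

variable {X : Type*} [MetricSpace X]

/-- A continuous 1-cocycle of bounded Alexander-Spanier cohomology, given by a representing
cochain `α : X × X → ℝ`: it is bounded, continuous near the diagonal, and its coboundary
`(x, y, z) ↦ α(y, z) - α(x, z) + α(x, y)` vanishes near the diagonal. -/
structure IsContinuousCocycle (α : X → X → ℝ) : Prop where
  bounded : ∃ B : ℝ, ∀ x y, |α x y| ≤ B
  continuous_near : ∃ ε > 0, ContinuousOn (fun p : X × X => α p.1 p.2) {p | dist p.1 p.2 < ε}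
  closed : ∃ ε > 0, ∀ x y z, dist x y < ε → dist y z < ε → dist x z < ε →
    α y z - α x z + α x y = 0

/-- `β` is a continuous function on `S` with `α = δβ` on `S`, as Alexander-Spanier cochains, that
is, up to cochains which vanish near the diagonal. -/
def IsPrimitiveOn (α : X → X → ℝ) (β : X → ℝ) (S : Set X) : Prop :=
  ContinuousOn β S ∧ ∃ ε > 0, ∀ x ∈ S, ∀ y ∈ S, dist x y < ε → α x y = β y - β x

/-- A cocycle is trivial if it is a coboundary. -/
def IsTrivialCocycle (α : X → X → ℝ) : Prop :=
  ∃ β : X → ℝ, IsPrimitiveOn α β univ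

/-- `I` is the integral of `α` along the curve `γ : [a, b] → X`: for all sufficiently fine
partitions `a = t₀ ≤ ⋯ ≤ tₙ = b` the sum `∑ α(γ(tₖ), γ(tₖ₊₁))` is equal to `I`. -/
def HasCurveIntegral (α : X → X → ℝ) (γ : ℝ → X) (a b I : ℝ) : Prop :=
  ∃ δ > 0, ∀ (n : ℕ) (t : ℕ → ℝ), Monotone t → t 0 = a → t n = b →
    (∀ k < n, t (k + 1) - t k < δ) →
    ∑ k ∈ Finset.range n, α (γ (t k)) (γ (t (k + 1))) = I

/-- The integral of `α` along the curve `γ : [a, b] → X`. For a cocycle, a continuous curve and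
`a ≤ b` it exists and is unique, see `hasCurveIntegral_curveIntegral` and
`HasCurveIntegral.eq`. -/
noncomputable def curveIntegral (α : X → X → ℝ) (γ : ℝ → X) (a b : ℝ) : ℝ :=
  Classical.epsilon (HasCurveIntegral α γ a b)

theorem HasCurveIntegral.eq {α : X → X → ℝ} {γ : ℝ → X} {a b I J : ℝ} (hab : a ≤ b)
    (hI : HasCurveIntegral α γ a b I) (hJ : HasCurveIntegral α γ a b J) : I = J := by
  obtain ⟨δ, hδ, h⟩ := hI
  obtain ⟨δ', hδ', h'⟩ := hJ
  set η := min δ δ' / 2 with hη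
  have hm : 0 < min δ δ' := lt_min hδ hδ'
  have hηpos : 0 < η := by positivity
  obtain ⟨n, hn⟩ := exists_nat_ge ((b - a) / η)
  rw [div_le_iff₀ hηpos] at hn
  let t : ℕ → ℝ := fun k => min (a + k * η) b
  have hmono : Monotone t := by
    intro i j hij
    have : (i : ℝ) ≤ j := by exact_mod_cast hij
    exact min_le_min_right b (by nlinarith)
  have h0 : t 0 = a := by simp [t, hab]
  have h1 : t n = b := by
    have : b ≤ a + n * η := by linarith
    simp [t, this]
  have hstep : ∀ k, t (k + 1) - t k ≤ η := by
    intro k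
    simp only [t]
    push_cast
    rcases le_total (a + k * η) b with hk | hk
    · rw [min_eq_left hk]
      have := min_le_left (a + ((k : ℝ) + 1) * η) b
      linarith
    · rw [min_eq_right hk]
      have := min_le_right (a + ((k : ℝ) + 1) * η) b
      linarith
  have hlt : η < min δ δ' := by rw [hη]; linarith
  rw [← h n t hmono h0 h1 fun k _ => (hstep k).trans_lt (hlt.trans_le (min_le_left _ _)),
    ← h' n t hmono h0 h1 fun k _ => (hstep k).trans_lt (hlt.trans_le (min_le_right _ _))]

theorem exists_hasCurveIntegral {α : X → X → ℝ} (hα : IsContinuousCocycle α) {γ : ℝ → X}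
    (hγ : Continuous γ) (a b : ℝ) : ∃ I, HasCurveIntegral α γ a b I := by
  obtain ⟨ε, hε, hc⟩ := hα.closed
  have hdiag : ∀ x, α x x = 0 := by
    intro x
    have := hc x x x (by simpa) (by simpa) (by simpa)
    linarith
  have hu : UniformContinuousOn γ (Icc a b) :=
    isCompact_Icc.uniformContinuousOn_of_continuous hγ.continuousOn
  obtain ⟨δ, hδ, hd⟩ := Metric.uniformContinuousOn_iff.1 hu (ε / 2) (by positivity)
  set η := δ / 2 with hη
  have hηpos : 0 < η := by positivity
  obtain ⟨N, hN⟩ := exists_nat_ge ((b - a) / η)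
  rw [div_le_iff₀ hηpos] at hN
  -- a primitive of `α` along `γ`
  let p : ℝ → ℕ → ℝ := fun u k => min u (a + k * η)
  let F : ℝ → ℝ := fun u => ∑ k ∈ Finset.range N, α (γ (p u k)) (γ (p u (k + 1)))
  have hmem : ∀ u ∈ Icc a b, ∀ k, p u k ∈ Icc a b := by
    intro u hx k
    refine ⟨le_min hx.1 ?_, (min_le_left _ _).trans hx.2⟩
    have : (0 : ℝ) ≤ k * η := by positivity
    linarith
  have hF : ∀ u ∈ Icc a b, ∀ v ∈ Icc a b, |u - v| < δ →
      F v - F u = α (γ u) (γ v) := by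
    intro u hx v hv huv
    have hpuv : ∀ k, dist (γ (p u k)) (γ (p v k)) < ε / 2 := by
      intro k
      refine hd _ (hmem u hx k) _ (hmem v hv k) ?_
      rw [Real.dist_eq]
      refine lt_of_le_of_lt ?_ huv
      have := abs_min_sub_min_le_max u (a + k * η) v (a + k * η)
      simpa using this
    have hpk : ∀ w ∈ Icc a b, ∀ k, dist (γ (p w k)) (γ (p w (k + 1))) < ε / 2 := by
      intro w hw k
      refine hd _ (hmem w hw k) _ (hmem w hw (k + 1)) ?_
      rw [Real.dist_eq]
      have := abs_min_sub_min_le_max w (a + k * η) w (a + ((k + 1 : ℕ) : ℝ) * η)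
      refine lt_of_le_of_lt this ?_
      push_cast
      have h2 : a + (k : ℝ) * η - (a + ((k : ℝ) + 1) * η) = -η := by ring
      rw [h2, abs_neg, abs_of_pos hηpos]
      simp only [sub_self, abs_zero]
      rw [max_eq_right hηpos.le]
      linarith
    have hterm : ∀ k, α (γ (p v k)) (γ (p v (k + 1))) - α (γ (p u k)) (γ (p u (k + 1))) =
        α (γ (p u (k + 1))) (γ (p v (k + 1))) - α (γ (p u k)) (γ (p v k)) := by
      intro k
      have h1 := hpuv k
      have h2 := hpuv (k + 1)
      have h3 := hpk u hx k
      have h4 := hpk v hv k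
      have h5 : dist (γ (p u k)) (γ (p v (k + 1))) < ε := by
        have := dist_triangle (γ (p u k)) (γ (p v k)) (γ (p v (k + 1)))
        linarith
      have e1 := hc _ _ _ (h1.trans (by linarith)) (h4.trans (by linarith)) h5
      have e2 := hc _ _ _ (h3.trans (by linarith)) (h2.trans (by linarith)) h5
      linarith
    have hsum : F v - F u = α (γ (p u N)) (γ (p v N)) - α (γ (p u 0)) (γ (p v 0)) := by
      simp only [F]
      rw [← Finset.sum_sub_distrib, Finset.sum_congr rfl fun k _ => hterm k]
      exact Finset.sum_range_sub (fun k => α (γ (p u k)) (γ (p v k))) N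
    have hp0 : ∀ w ∈ Icc a b, p w 0 = a := by
      intro w hw
      simp [p, hw.1]
    have hpN : ∀ w ∈ Icc a b, p w N = w := by
      intro w hw
      have : w ≤ a + N * η := by linarith [hw.2]
      simp [p, this]
    rw [hsum, hp0 u hx, hp0 v hv, hpN u hx, hpN v hv, hdiag, sub_zero]
  refine ⟨F b - F a, δ, hδ, ?_⟩
  intro n t hmono h0 h1 hstep
  have hmemt : ∀ k ≤ n, t k ∈ Icc a b := fun k hk =>
    ⟨h0 ▸ hmono (Nat.zero_le k), h1 ▸ hmono hk⟩
  have : ∀ k ∈ Finset.range n, α (γ (t k)) (γ (t (k + 1))) = F (t (k + 1)) - F (t k) := by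
    intro k hk
    have hk' := Finset.mem_range.1 hk
    refine (hF _ (hmemt k hk'.le) _ (hmemt (k + 1) hk') ?_).symm
    rw [abs_sub_comm, abs_of_nonneg (sub_nonneg.2 (hmono (Nat.le_succ k)))]
    exact hstep k hk'
  rw [Finset.sum_congr rfl this, Finset.sum_range_sub (fun k => F (t k)), h0, h1]

theorem hasCurveIntegral_curveIntegral {α : X → X → ℝ} (hα : IsContinuousCocycle α) {γ : ℝ → X}
    (hγ : Continuous γ) (a b : ℝ) :
    HasCurveIntegral α γ a b (curveIntegral α γ a b) :=
  Classical.epsilon_spec (exists_hasCurveIntegral hα hγ a b)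

end Cocycles

/-! ### Flows -/

section Flows

variable {X : Type*} [MetricSpace X]

/-- The set of fixed points of a flow. -/
def fixedPointSet (φ : Flow ℝ X) : Set X :=
  {x | ∀ t, φ t x = x}

/-- A flow is gradient-like if it has a Lyapunov function: a continuous real function which is
strictly decreasing along every nonconstant trajectory. -/
def IsGradientLike (φ : Flow ℝ X) : Prop :=
  ∃ g : X → ℝ, Continuous g ∧ ∀ x, x ∉ fixedPointSet φ → StrictAnti fun t : ℝ => g (φ t x)

/-- The maximal invariant subset of `N`. -/
def invariantPart (φ : Flow ℝ X) (N : Set X) : Set X :=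
  {x | ∀ t, φ t x ∈ N}

/-- `N` is an isolating neighbourhood of `A` (the phase space is compact in the applications, so
closed sets are compact). -/
def IsIsolatingNeighborhood (φ : Flow ℝ X) (A N : Set X) : Prop :=
  IsClosed N ∧ A ⊆ interior N ∧ invariantPart φ N = A

/-- `A` is an isolated invariant set. -/
def IsIsolatedInvariant (φ : Flow ℝ X) (A : Set X) : Prop :=
  IsClosed A ∧ ∃ N, IsIsolatingNeighborhood φ A N

/-- The flow neighbourhood `A(V, r)` of `A`: the points of `V` whose trajectory, followed forward
or backward in time, reaches the closed `r`-neighbourhood of `A` without leaving `V` before. -/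
def flowNeighborhood (φ : Flow ℝ X) (A V : Set X) (r : ℝ) : Set X :=
  {x | ∃ t : ℝ, φ t x ∈ Metric.cthickening r A ∧ ∀ u ∈ uIcc 0 t, φ u x ∈ V}

/-- The integral of `α` along the trajectory `[x · a, x · b]`. -/
noncomputable def trajectoryIntegral (φ : Flow ℝ X) (α : X → X → ℝ) (x : X) (a b : ℝ) : ℝ :=
  curveIntegral α (fun t => φ t x) a b

/-- For a closed set `K`, the trajectory `t ↦ x · t` with domain `(a, b)` is a complete trajectory
of the flow restricted to the complement of `K`, with bounded domain. -/
def IsBoundedTrajectory (φ : Flow ℝ X) (K : Set X) (x : X) (a b : ℝ) : Prop :=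
  a < b ∧ φ a x ∈ K ∧ φ b x ∈ K ∧ ∀ t ∈ Ioo a b, φ t x ∉ K

/-- For a closed set `K`, the piece `[x · a, x · b]` lies on a trajectory of the flow restricted to
the complement of `K` whose domain is unbounded, that is, of the form `(c, ∞)`, `(-∞, c)` or
`(-∞, ∞)`. -/
def IsInUnboundedTrajectory (φ : Flow ℝ X) (K : Set X) (x : X) (a b : ℝ) : Prop :=
  a ≤ b ∧ ((∀ t, a ≤ t → φ t x ∉ K) ∨ (∀ t, t ≤ b → φ t x ∉ K))

/-- `φ` is a generalized `α`-flow with respect to the isolated invariant set `⋃ i, A i` with the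
finitely many connected components `A i`. -/
structure IsGeneralizedAlphaFlow (φ : Flow ℝ X) (α : X → X → ℝ) {n : ℕ}
    (A : Fin n → Set X) : Prop where
  cocycle : IsContinuousCocycle α
  finite_components_fixedPointSet : Finite (ConnectedComponents (fixedPointSet φ))
  /- the sets `A i` are the connected components of their union -/
  isClosed : ∀ i, IsClosed (A i)
  isConnected : ∀ i, IsConnected (A i)
  disjoint : Pairwise fun i j => Disjoint (A i) (A j)
  isolated : IsIsolatedInvariant φ (⋃ i, A i)
  fixedPointSet_subset : fixedPointSet φ ⊆ ⋃ i, A i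
  /- `V i` is a closed neighbourhood of `A i` in an isolating neighbourhood, hence isolating, and
  `A i (r)` is the flow neighbourhood given by `V i` and the small number `r` -/
  carries : ∃ (V : Fin n → Set X) (r T₀ ρ lam : ℝ),
    (∀ i, IsIsolatingNeighborhood φ (A i) (V i)) ∧
    (Pairwise fun i j => Disjoint (V i) (V j)) ∧
    0 < r ∧ (∀ i, Metric.cthickening r (A i) ⊆ V i) ∧
    0 < T₀ ∧ 0 < ρ ∧ 0 ≤ lam ∧ lam < 1 ∧
    (∀ i, ∃ β : X → ℝ, IsPrimitiveOn α β (flowNeighborhood φ (A i) (V i) r) ∧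
      ∀ x ∈ flowNeighborhood φ (A i) (V i) r, ∀ y ∈ flowNeighborhood φ (A i) (V i) r,
        |β y - β x| ≤ lam * ρ) ∧
    (∀ x a b, IsBoundedTrajectory φ (⋃ i, flowNeighborhood φ (A i) (V i) r) x a b →
      ρ ≤ trajectoryIntegral φ α x a b) ∧
    (∀ x a, IsInUnboundedTrajectory φ (⋃ i, flowNeighborhood φ (A i) (V i) r) x a (a + T₀) →
      ρ ≤ trajectoryIntegral φ α x a (a + T₀))

/-- `φ` is an `α`-flow: a generalized `α`-flow with respect to an isolated invariant set which
consists of finitely many (possibly no) points. -/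
def IsAlphaFlow (φ : Flow ℝ X) (α : X → X → ℝ) : Prop :=
  ∃ (n : ℕ) (p : Fin n → X), IsGeneralizedAlphaFlow φ α fun i => {p i}

/-! ### Chains -/

/-- The data `{x₀, …, xₙ | t₀, …, tₙ₋₁}` of a chain. -/
structure Chain (X : Type*) where
  length : ℕ
  point : Fin (length + 1) → X
  time : Fin length → ℝ

/-- The family of the open balls of radius `s` with centers in `C` covers `X`. -/
def IsBallCovering (C : Set X) (s : ℝ) : Prop :=
  ⋃ c ∈ C, Metric.ball c s = univ

/-- `γ` is a `(𝒰(s), T)`-chain, where `𝒰(s)` consists of the balls of radius `s` with centers in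
`C`: each time is at least `T`, and the end `xₖ · tₖ` of each piece and the starting point `xₖ₊₁`
of the next piece lie in a common ball of `𝒰(s)`. -/
def Chain.IsChain (φ : Flow ℝ X) (C : Set X) (s T : ℝ) (γ : Chain X) : Prop :=
  0 < γ.length ∧ ∀ k : Fin γ.length, T ≤ γ.time k ∧
    ∃ c ∈ C, φ (γ.time k) (γ.point k.castSucc) ∈ Metric.ball c s ∧
      γ.point k.succ ∈ Metric.ball c s

/-- The integral of `α` along a chain: the integrals along the pieces of trajectories, together
with the values of `α` on the jumps. (On a small ball `α = δβ`, and the value on a jump from `y` to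
`z` inside of this ball is `β z - β y`.) -/
noncomputable def Chain.integral (φ : Flow ℝ X) (α : X → X → ℝ) (γ : Chain X) : ℝ :=
  ∑ k : Fin γ.length, (trajectoryIntegral φ α (γ.point k.castSucc) 0 (γ.time k) +
    α (φ (γ.time k) (γ.point k.castSucc)) (γ.point k.succ))

end Flows

end CocycleFlow

namespace CocycleFlow

/-! ### Lyapunov functions from chain transitivity -/

section Lyapunov

variable {X : Type*} [MetricSpace X]

/-! Suppose that all chains have integral less than `M`. A single long piece of trajectory is a
chain of length one with a zero jump, so integrals over long pieces are bounded above. Each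
excursion from `⋃ i, K i` gains at least `ρ`, while a visit to one `K i` costs at most `lam * ρ <
ρ`. Hence a forward trajectory makes only finitely many excursions, ends up in one `K i` and
converges to `p i` (`IsCarriedBy.eventually_mem`, `tendsto_of_eventually_mem_isolating`).

A Conley-type argument (`isGradientLike_of_not_chainReaches`) shows that a flow which is not
gradient-like has a nonconstant orbit consisting of chain recurrent points; let `z` be a point of it
outside all `V i`. Its forward limit is some `p i` from which `z` is chain reachable. Then `z` is
also reachable from a point `y ≠ p i` of the unstable set of `p i` (`exists_unstable_chainReaches`),
hence from the forward limit of `y`, and so on. This yields an endless sequence of connecting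
orbits, each starting at the fixed point where the previous one ends; it need not close up.

Following many of them, with small jumps near the fixed points, gives a net gain of at least `ρ -
lam * ρ` per connection (`IsCarriedBy.exists_large_chain`), which contradicts the bound `M`. -/

theorem continuous_orbit (φ : Flow ℝ X) (x : X) : Continuous fun t => φ t x :=
  φ.continuous continuous_id continuous_const

theorem continuous_time (φ : Flow ℝ X) (t : ℝ) : Continuous fun x => φ t x :=
  φ.continuous continuous_const continuous_id

/-- A continuous function `F` which does not increase under the time-one map of the flow, and which
on each nonconstant orbit decreases at some place, gives rise to a Lyapunov function. -/
theorem isGradientLike_of_timeOne [CompactSpace X] (φ : Flow ℝ X) (F : X → ℝ) (hF : Continuous F)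
    (hle : ∀ x, F (φ 1 x) ≤ F x)
    (hlt : ∀ x, x ∉ fixedPointSet φ → ∃ u, F (φ (2 + u) x) < F (φ u x)) : IsGradientLike φ := by
  have hFc : ∀ x, Continuous fun t => F (φ t x) := fun x => hF.comp (continuous_orbit φ x)
  have hFi : ∀ x a b, IntervalIntegrable (fun t => F (φ t x)) MeasureTheory.volume a b :=
    fun x a b => (hFc x).intervalIntegrable a b
  have hFi' : ∀ {x} a b, IntervalIntegrable (fun t => F (φ (t + 1) x)) MeasureTheory.volume a b :=
    fun {x} a b => ((hFc x).comp (continuous_add_const 1)).intervalIntegrable a b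
  -- Averaging over unit time makes the function nonincreasing along the whole flow: its change over
  -- `[s, t]` is the integral of `F (φ (u + 1) x) - F (φ u x)`.
  let G : X → ℝ := fun x => ∫ t in (0 : ℝ)..1, F (φ t x)
  have hG : Continuous G := by
    refine intervalIntegral.continuous_parametric_intervalIntegral_of_continuous' ?_ 0 1
    exact hF.comp (φ.continuous continuous_snd continuous_fst)
  have hGs : ∀ x s, G (φ s x) = ∫ t in s..s + 1, F (φ t x) := by
    intro x s
    have := intervalIntegral.integral_comp_add_right (a := 0) (b := 1) (fun t => F (φ t x)) s
    simp only [G, ← φ.map_add]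
    rw [this, zero_add, add_comm 1 s]
  have hstep : ∀ x t, F (φ (t + 1) x) ≤ F (φ t x) := by
    intro x t
    rw [add_comm, φ.map_add]
    exact hle _
  have hanti : ∀ x, Antitone fun s => G (φ s x) := by
    intro x s t hst
    have h1 : G (φ s x) - G (φ t x) =
        ∫ u in s..t, (F (φ u x) - F (φ (u + 1) x)) := by
      rw [hGs, hGs, intervalIntegral.integral_interval_sub_interval_comm (hFi _ _ _) (hFi _ _ _)
        (hFi _ _ _), intervalIntegral.integral_sub (hFi _ _ _)
        (hFi' _ _),
        intervalIntegral.integral_comp_add_right (fun t => F (φ t x)) 1]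
    have h2 : 0 ≤ ∫ u in s..t, (F (φ u x) - F (φ (u + 1) x)) :=
      intervalIntegral.integral_nonneg hst fun u _ => sub_nonneg.2 (hstep x u)
    show G (φ t x) ≤ G (φ s x)
    linarith
  have hnonconst : ∀ x, x ∉ fixedPointSet φ → ∃ u, G (φ (2 + u) x) < G (φ u x) := by
    intro x hx
    obtain ⟨u, hu⟩ := hlt x hx
    refine ⟨u, ?_⟩
    show (∫ t in (0 : ℝ)..1, F (φ t (φ (2 + u) x))) < ∫ t in (0 : ℝ)..1, F (φ t (φ u x))
    refine intervalIntegral.integral_lt_integral_of_continuousOn_of_le_of_exists_lt one_pos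
      (hFc _).continuousOn (hFc _).continuousOn ?_ ⟨0, by simp, by simpa using hu⟩
    intro t _
    have h1 := hstep x (t + u)
    have h2 := hstep x (t + u + 1)
    rw [← φ.map_add, ← φ.map_add, show t + (2 + u) = t + u + 1 + 1 by ring]
    linarith
  obtain ⟨B, hB⟩ : ∃ B, ∀ x, ‖G x‖ ≤ B := by
    obtain ⟨B, hB⟩ := isCompact_univ.exists_bound_of_continuousOn hG.continuousOn
    exact ⟨B, fun x => hB x (mem_univ x)⟩
  -- Averaging over the entire orbit with an everywhere positive weight spreads a strict decrease at
  -- one place to all times.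
  let w : ℝ → ℝ := fun u => Real.exp (-1 * u ^ 2)
  have hw : MeasureTheory.Integrable w := integrable_exp_neg_mul_sq one_pos
  have hwc : Continuous w := by fun_prop
  have hwpos : ∀ u, 0 < w u := fun u => Real.exp_pos _
  have hcont : ∀ x, Continuous fun u => G (φ u x) := fun x => hG.comp (continuous_orbit φ x)
  have hint : ∀ x, MeasureTheory.Integrable fun u => G (φ u x) * w u := fun x =>
    hw.bdd_mul (hcont x).aestronglyMeasurable (Eventually.of_forall fun u => hB _)
  refine ⟨fun x => ∫ u, G (φ u x) * w u, ?_, ?_⟩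
  · refine MeasureTheory.continuous_of_dominated (bound := fun u => B * w u)
      (fun x => (hint x).aestronglyMeasurable) ?_ (hw.const_mul B) ?_
    · refine fun x => Eventually.of_forall fun u => ?_
      rw [norm_mul, Real.norm_of_nonneg (hwpos u).le]
      exact mul_le_mul_of_nonneg_right (hB _) (hwpos u).le
    · exact Eventually.of_forall fun u => (hG.comp (continuous_time φ u)).mul continuous_const
  · intro x hx s t hst
    have hle' : ∀ u, G (φ u (φ t x)) ≤ G (φ u (φ s x)) := by
      intro u
      rw [← φ.map_add, ← φ.map_add]
      exact hanti x (by linarith)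
    -- Otherwise `G` would be periodic along the orbit with period `t - s`; being monotone it would
    -- be constant, against `hnonconst`.
    obtain ⟨u, hu⟩ : ∃ u, G (φ u (φ t x)) < G (φ u (φ s x)) := by
      by_contra! hcon
      have heq : ∀ u, G (φ (u + t) x) = G (φ (u + s) x) := by
        intro u
        rw [φ.map_add, φ.map_add]
        exact le_antisymm (hle' u) (hcon u)
      have hper : ∀ (k : ℕ) u, G (φ (u + k * (t - s)) x) = G (φ u x) := by
        intro k
        induction k with
        | zero => intro u; simp
        | succ k ih =>
          intro u
          have := heq (u + k * (t - s) - s)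
          rw [← ih u]
          convert this using 3
          · push_cast; ring
          · ring
      obtain ⟨u, hu⟩ := hnonconst x hx
      obtain ⟨k, hk⟩ := exists_nat_ge (2 / (t - s))
      rw [div_le_iff₀ (sub_pos.2 hst)] at hk
      have h1 : G (φ (u + k * (t - s)) x) ≤ G (φ (2 + u) x) := hanti x (by linarith)
      rw [hper] at h1
      linarith
    show (∫ u, G (φ u (φ t x)) * w u) < ∫ u, G (φ u (φ s x)) * w u
    rw [← sub_pos, ← MeasureTheory.integral_sub (hint _) (hint _)]
    refine MeasureTheory.integral_pos_of_integrable_nonneg_nonzero (x := u)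
      (((hcont _).mul hwc).sub ((hcont _).mul hwc)) ((hint _).sub (hint _)) ?_ ?_
    · intro v
      have := mul_le_mul_of_nonneg_right (hle' v) (hwpos v).le
      exact sub_nonneg.2 this
    · have := mul_lt_mul_of_pos_right hu (hwpos u)
      exact (sub_pos.2 this).ne'

/-- A step of an `ε`-pseudo-orbit of the time-one map. -/
def PseudoStep (φ : Flow ℝ X) (ε : ℝ) (x y : X) : Prop :=
  dist (φ 1 x) y < ε

/-- For every `ε > 0` there is an `ε`-pseudo-orbit of the time-one map from `x` to `y`. -/
def ChainReaches (φ : Flow ℝ X) (x y : X) : Prop :=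
  ∀ ε > 0, Relation.TransGen (PseudoStep φ ε) x y

/-- The set `U` of points reached from `x` by `ε`-pseudo-orbits is open and `φ 1` maps its closure
into it. A Urysohn function that is 0 on `φ 1 (closure U)` and 1 outside `U` is therefore
nonincreasing under `φ 1`. -/
theorem exists_timeOne_decreasing [CompactSpace X] (φ : Flow ℝ X) {x : X}
    (hx : ¬ ChainReaches φ x x) :
    ∃ f : X → ℝ, Continuous f ∧ (∀ y, f y ∈ Icc (0 : ℝ) 1) ∧ (∀ y, f (φ 1 y) ≤ f y) ∧
      f (φ 2 x) < f x := by
  simp only [ChainReaches, not_forall] at hx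
  obtain ⟨ε, hε, hx⟩ := hx
  set U : Set X := {y | Relation.TransGen (PseudoStep φ ε) x y} with hU
  have hUopen : IsOpen U := by
    rw [isOpen_iff_mem_nhds]
    intro y hy
    obtain ⟨z, hz, hzy⟩ := Relation.TransGen.tail'_iff.1 hy
    have : Metric.ball (φ 1 z) ε ∈ 𝓝 y := Metric.isOpen_ball.mem_nhds (by
      rw [Metric.mem_ball']; exact hzy)
    filter_upwards [this] with y' hy'
    exact Relation.TransGen.tail' hz (by rwa [Metric.mem_ball'] at hy')
  have htrap : ∀ y ∈ closure U, φ 1 y ∈ U := by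
    intro y hy
    have : {z | dist (φ 1 z) (φ 1 y) < ε} ∈ 𝓝 y := by
      refine (isOpen_lt ((continuous_time φ 1).dist continuous_const)
        continuous_const).mem_nhds ?_
      simpa using hε
    obtain ⟨z, hz, hzU⟩ := mem_closure_iff_nhds.1 hy _ this
    exact hzU.tail hz
  have hcl : IsClosed ((fun y => φ 1 y) '' closure U) :=
    (isClosed_closure.isCompact.image (continuous_time φ 1)).isClosed
  obtain ⟨f, hf0, hf1, hf⟩ := exists_continuous_zero_one_of_isClosed hcl hUopen.isClosed_compl
    (by
      rw [disjoint_compl_right_iff_subset]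
      rintro _ ⟨y, hy, rfl⟩
      exact htrap y hy)
  refine ⟨f, f.continuous, hf, ?_, ?_⟩
  · intro y
    by_cases hy : y ∈ closure U
    · rw [hf0 (mem_image_of_mem _ hy)]
      exact (hf y).1
    · rw [hf1 (fun h => hy (subset_closure h))]
      exact (hf _).2
  -- Two time steps are needed: `x` lies outside `U`, `φ 1 x` lies in `U`, and only `φ 2 x` is
  -- certain to lie in the zero set.
  · have h1 : φ 1 x ∈ U := Relation.TransGen.single (by simpa [PseudoStep] using hε)
    have h2 : φ 2 x = φ 1 (φ 1 x) := by rw [← φ.map_add]; norm_num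
    rw [h2, hf0 (mem_image_of_mem (fun y => φ 1 y) (subset_closure h1)), hf1 hx]
    norm_num

/-- If every nonconstant orbit contains a point which is not chain recurrent, then the flow is
gradient-like. -/
theorem isGradientLike_of_not_chainReaches [CompactSpace X] (φ : Flow ℝ X)
    (h : ∀ x, x ∉ fixedPointSet φ → ∃ u, ¬ ChainReaches φ (φ u x) (φ u x)) :
    IsGradientLike φ := by
  choose! u hu using h
  have hex := fun x (hx : x ∉ fixedPointSet φ) => exists_timeOne_decreasing φ (hu x hx)
  choose! f hfc hf01 hfle hflt using hex
  let N : Set X := (fixedPointSet φ)ᶜ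
  let O : X → Set X := fun y => {z | f y (φ (2 + u y) z) < f y (φ (u y) z)}
  have hO : ∀ y ∈ N, O y ∈ 𝓝[N] y := by
    intro y hy
    refine mem_nhdsWithin_of_mem_nhds (IsOpen.mem_nhds ?_ ?_)
    · exact isOpen_lt ((hfc y hy).comp (continuous_time φ _))
        ((hfc y hy).comp (continuous_time φ _))
    · show f y (φ (2 + u y) y) < f y (φ (u y) y)
      rw [φ.map_add]
      exact hflt y hy
  -- Countably many of the functions `f y` suffice to detect every nonconstant orbit, so a
  -- geometrically weighted sum does so at once.
  obtain ⟨S, hSN, hSc, hcov⟩ := TopologicalSpace.countable_cover_nhdsWithin hO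
  rcases S.eq_empty_or_nonempty with rfl | hne
  · refine ⟨fun _ => 0, continuous_const, fun x hx => ?_⟩
    have := hcov hx
    simp at this
  obtain ⟨e, rfl⟩ := hSc.exists_eq_range hne
  have he : ∀ k, e k ∉ fixedPointSet φ := fun k => hSN (mem_range_self k)
  let c : ℕ → ℝ := fun k => (1 / 2) ^ k
  have hc : Summable c := summable_geometric_two
  have hcpos : ∀ k, 0 < c k := fun k => by positivity
  have hbound : ∀ k x, ‖c k * f (e k) x‖ ≤ c k := by
    intro k x
    have := hf01 _ (he k) x
    rw [norm_mul, Real.norm_of_nonneg (hcpos k).le, Real.norm_of_nonneg this.1]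
    exact mul_le_of_le_one_right (hcpos k).le this.2
  have hsum : ∀ x, Summable fun k => c k * f (e k) x := fun x =>
    Summable.of_norm_bounded hc (hbound · x)
  have hle1 : ∀ k x, c k * f (e k) (φ 1 x) ≤ c k * f (e k) x := fun k x =>
    mul_le_mul_of_nonneg_left (hfle _ (he k) x) (hcpos k).le
  refine isGradientLike_of_timeOne φ (fun x => ∑' k, c k * f (e k) x)
    (continuous_tsum (fun k => continuous_const.mul (hfc _ (he k))) hc hbound) ?_ ?_
  · exact fun x => (hsum _).tsum_le_tsum (fun k => hle1 k x) (hsum _)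
  · intro x hx
    obtain ⟨_, ⟨k, rfl⟩, hk⟩ := mem_iUnion₂.1 (hcov hx)
    refine ⟨u (e k), Summable.tsum_lt_tsum (i := k) (fun j => ?_)
      (mul_lt_mul_of_pos_left hk (hcpos k)) (hsum _) (hsum _)⟩
    have h1 := hle1 j (φ (u (e k)) x)
    have h2 := hle1 j (φ 1 (φ (u (e k)) x))
    rw [← φ.map_add 1 1, one_add_one_eq_two, ← φ.map_add 2] at h2
    exact h2.trans h1

end Lyapunov

/-! ### Orbits near an isolated fixed point -/

section Isolated

variable {X : Type*} [MetricSpace X]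

/-- Every cluster point has its whole orbit in the closed set `V`, so it equals `p`; compactness
turns this into convergence. The general filter covers both time directions. -/
theorem tendsto_of_eventually_mem_isolating [CompactSpace X] (φ : Flow ℝ X) {V : Set X} {p x : X}
    {l : Filter ℝ} (hV : IsClosed V) (hinv : invariantPart φ V = {p})
    (h : ∀ s, ∀ᶠ t in l, φ (s + t) x ∈ V) : Tendsto (fun t => φ t x) l (𝓝 p) := by
  refine isCompact_univ.tendsto_nhds_of_unique_mapClusterPt (by simp) fun q _ hq => ?_
  have : q ∈ invariantPart φ V := by
    intro s
    have h1 : MapClusterPt (φ s q) l ((fun y => φ s y) ∘ fun t => φ t x) :=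
      hq.continuousAt_comp (continuous_time φ s).continuousAt
    refine hV.mem_of_mapClusterPt h1 ?_
    filter_upwards [h s] with t ht
    rwa [φ.map_add] at ht
  rwa [hinv] at this

/-- The second point of a pseudo-orbit from `y` to `x` can be reached by one step from `φ 1 y`, by
uniform continuity of `φ 1`. Recurrence of `x` supplies this second point when the pseudo-orbit has
only one step. -/
theorem chainReaches_timeOne [CompactSpace X] (φ : Flow ℝ X) {x y : X} (hx : ChainReaches φ x x)
    (hy : ChainReaches φ y x) : ChainReaches φ (φ 1 y) x := by
  intro ε hε
  have huc := CompactSpace.uniformContinuous_of_continuous (continuous_time φ 1)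
  obtain ⟨δ, hδ, hd⟩ := Metric.uniformContinuous_iff.1 huc (ε / 2) (by positivity)
  have hm : 0 < min δ (ε / 2) := lt_min hδ (by positivity)
  have hmono : ∀ a b, PseudoStep φ (min δ (ε / 2)) a b → PseudoStep φ ε a b := fun a b hab =>
    lt_of_lt_of_le hab ((min_le_right _ _).trans (by linarith))
  obtain ⟨z, hyz, hzx⟩ := Relation.TransGen.head'_iff.1 (hy _ hm)
  obtain ⟨z', hzz, hzx'⟩ := Relation.TransGen.head'_iff.1 ((hx _ hm).trans_right hzx)
  refine Relation.TransGen.head' (b := z') ?_ (Relation.ReflTransGen.mono hmono _ _ hzx')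
  have h1 := hd (lt_of_lt_of_le hyz (min_le_left _ _))
  have h2 := lt_of_lt_of_le hzz (min_le_right _ _)
  have h3 := dist_triangle (φ 1 (φ 1 y)) (φ 1 z) z'
  show dist (φ 1 (φ 1 y)) z' < ε
  linarith

/-- A chain recurrent point reached from `y` is reached from the limit of the trajectory of `y`. -/
theorem chainReaches_of_tendsto [CompactSpace X] (φ : Flow ℝ X) {x y p : X}
    (hx : ChainReaches φ x x) (hy : ChainReaches φ y x) (hp : p ∈ fixedPointSet φ)
    (h : Tendsto (fun t => φ t y) atTop (𝓝 p)) : ChainReaches φ p x := by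
  have hn : ∀ n : ℕ, ChainReaches φ (φ n y) x := by
    intro n
    induction n with
    | zero => simpa using hy
    | succ n ih =>
      have := chainReaches_timeOne φ hx ih
      rwa [← φ.map_add, add_comm, ← Nat.cast_succ] at this
  intro ε hε
  obtain ⟨n, hn'⟩ := ((h.comp tendsto_natCast_atTop_atTop).eventually
    (Metric.ball_mem_nhds p hε)).exists
  refine Relation.TransGen.head ?_ (hn n ε hε)
  rw [PseudoStep, hp 1]
  exact Metric.mem_ball'.1 hn'

/-- The pseudo-orbit is cut at its first point outside `B` and read backward, so larger indices are
earlier times. Since `p` is fixed, the sequence can be continued by `p` forever. -/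
theorem exists_backward_pseudoOrbit (φ : Flow ℝ X) {B : Set X} {p x : X} {ε : ℝ} (hε : 0 < ε)
    (hp : p ∈ fixedPointSet φ) (hpB : p ∈ B) (hxB : x ∉ B)
    (h : Relation.TransGen (PseudoStep φ ε) p x) :
    ∃ w : ℕ → X, w 0 ∉ B ∧ (∀ j, w (j + 1) ∈ B) ∧ (∀ j, PseudoStep φ ε (w (j + 1)) (w j)) ∧
      Relation.ReflTransGen (PseudoStep φ ε) (w 0) x := by
  have key : ∀ z, Relation.ReflTransGen (PseudoStep φ ε) p z →
      (∃ w : ℕ → X, w 0 = z ∧ (∀ j, w j ∈ B) ∧ ∀ j, PseudoStep φ ε (w (j + 1)) (w j)) ∨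
      ∃ w : ℕ → X, w 0 ∉ B ∧ (∀ j, w (j + 1) ∈ B) ∧ (∀ j, PseudoStep φ ε (w (j + 1)) (w j)) ∧
        Relation.ReflTransGen (PseudoStep φ ε) (w 0) z := by
    intro z hz
    induction hz with
    | refl => exact Or.inl ⟨fun _ => p, rfl, fun _ => hpB, fun _ => by simpa [PseudoStep, hp 1]⟩
    | @tail z z' _ hzz' ih =>
      rcases ih with ⟨w, rfl, hwB, hw⟩ | ⟨w, hw0, hwB, hw, hwz⟩
      · have hw' : ∀ j, PseudoStep φ ε ((fun k => Nat.casesOn k z' w : ℕ → X) (j + 1))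
            ((fun k => Nat.casesOn k z' w : ℕ → X) j) := by
          intro j
          cases j with
          | zero => exact hzz'
          | succ j => exact hw j
        by_cases hz' : z' ∈ B
        · refine Or.inl ⟨fun k => Nat.casesOn k z' w, rfl, fun j => ?_, hw'⟩
          cases j with
          | zero => exact hz'
          | succ j => exact hwB j
        · exact Or.inr ⟨fun k => Nat.casesOn k z' w, hz', hwB, hw', .refl⟩
      · exact Or.inr ⟨w, hw0, hwB, hw, hwz.tail hzz'⟩
  rcases key x h.to_reflTransGen with ⟨w, rfl, hwB, -⟩ | h
  · exact absurd (hwB 0) hxB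
  · exact h

/-- If a chain recurrent point `x` outside of an isolating neighbourhood of the fixed point `p` is
reached from `p`, then it is reached from some point `y ≠ p` of the unstable set of `p`. -/
theorem exists_unstable_chainReaches [CompactSpace X] (φ : Flow ℝ X) {V : Set X} {p x : X}
    (hV : IsIsolatingNeighborhood φ {p} V) (hp : p ∈ fixedPointSet φ) (hxV : x ∉ V)
    (hx : ChainReaches φ x x) (hpx : ChainReaches φ p x) :
    ∃ y, y ≠ p ∧ Tendsto (fun t => φ t y) atBot (𝓝 p) ∧ ChainReaches φ y x := by
  obtain ⟨hVc, hpV, hinv⟩ := hV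
  -- The time window lets membership at integer times control the continuous orbit in between.
  let B : Set X := {z | ∀ u ∈ Icc (-1 : ℝ) 1, φ u z ∈ V}
  have hBc : IsClosed B := by
    have : B = ⋂ u ∈ Icc (-1 : ℝ) 1, (fun z => φ u z) ⁻¹' V := by ext; simp [B]
    rw [this]
    exact isClosed_biInter fun u _ => hVc.preimage (continuous_time φ u)
  have hBp : B ∈ 𝓝 p := by
    have hev : ∀ u ∈ Icc (-1 : ℝ) 1, ∀ᶠ q : X × ℝ in 𝓝 (p, u), φ q.2 q.1 ∈ V := by
      intro u _
      have hc : ContinuousAt (fun q : X × ℝ => φ q.2 q.1) (p, u) :=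
        (φ.continuous continuous_snd continuous_fst).continuousAt
      refine hc ?_
      show V ∈ 𝓝 (φ u p)
      rw [hp u]
      exact mem_interior_iff_mem_nhds.1 (hpV rfl)
    exact isCompact_Icc.eventually_forall_of_forall_eventually hev
  have hBV : B ⊆ V := fun z hz => by simpa using hz 0 (by simp)
  choose w hw0 hwB hw hwx using fun n : ℕ => exists_backward_pseudoOrbit φ
    (Nat.one_div_pos_of_nat (n := n) (α := ℝ)) hp (mem_of_mem_nhds hBp) (fun h => hxV (hBV h))
    (hpx _ Nat.one_div_pos_of_nat)
  -- The point `y` is a limit of first exit points as the jumps shrink. Its backward orbit at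
  -- integer times is the limit of the reversed pseudo-orbits, hence lies in `B`.
  obtain ⟨y, ψ, hψ, hy⟩ := CompactSpace.tendsto_subseq fun n => w n 0
  have hε : Tendsto (fun n => 1 / ((ψ n : ℝ) + 1)) atTop (𝓝 0) :=
    tendsto_one_div_add_atTop_nhds_zero_nat.comp hψ.tendsto_atTop
  have hlim : ∀ j : ℕ, Tendsto (fun n => w (ψ n) j) atTop (𝓝 (φ (-(j : ℝ)) y)) := by
    intro j
    induction j with
    | zero => simpa [Function.comp_def] using hy
    | succ j ih =>
      have h1 : Tendsto (fun n => φ 1 (w (ψ n) (j + 1))) atTop (𝓝 (φ (-(j : ℝ)) y)) := by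
        refine tendsto_of_tendsto_of_dist ih ?_
        refine squeeze_zero (fun _ => dist_nonneg) (fun n => ?_) hε
        rw [dist_comm]
        exact (hw (ψ n) j).le
      have h2 := ((continuous_time φ (-1)).tendsto _).comp h1
      simp only [← φ.map_add] at h2
      refine (h2.congr fun n => ?_).trans_eq ?_
      · simp [← φ.map_add]
      · push_cast
        congr 2
        ring
  have hyB : ∀ j : ℕ, φ (-((j : ℝ) + 1)) y ∈ B := by
    intro j
    have := hBc.mem_of_tendsto (hlim (j + 1)) (Eventually.of_forall fun n => hwB (ψ n) j)
    rwa [Nat.cast_succ] at this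
  have hback : ∀ t ≤ 0, φ t y ∈ V := by
    intro t ht
    have h0 : 0 ≤ -t := by linarith
    have h1 := Nat.floor_le h0
    have h2 := Nat.lt_floor_add_one (-t)
    have := hyB ⌊-t⌋₊ (t + (⌊-t⌋₊ + 1)) ⟨by linarith, by linarith⟩
    rw [← φ.map_add] at this
    convert this using 2
    ring
  refine ⟨y, ?_, ?_, ?_⟩
  · rintro rfl
    have hy' : Tendsto (fun n => w (ψ n) 0) atTop (𝓝 y) := hy
    obtain ⟨n, hn⟩ := (hy'.eventually hBp).exists
    exact hw0 _ hn
  · refine tendsto_of_eventually_mem_isolating φ hVc hinv fun s => ?_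
    filter_upwards [eventually_le_atBot (-s)] with t ht
    exact hback _ (by linarith)
  · intro ε hε'
    have h1 := ((continuous_time φ 1).tendsto y).comp hy
    obtain ⟨n, hn1, hn2⟩ := ((h1.eventually (Metric.ball_mem_nhds _ (half_pos hε'))).and
      (hε.eventually (gt_mem_nhds (half_pos hε')))).exists
    have hmono : ∀ a b, PseudoStep φ (1 / ((ψ n : ℝ) + 1)) a b → PseudoStep φ ε a b :=
      fun a b hab => lt_trans hab (by linarith)
    -- Appending a loop at `x` ensures at least one step, even if the exit point is `x` itself.
    obtain ⟨z, hz, hzx⟩ := Relation.TransGen.head'_iff.1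
      ((hx _ (Nat.one_div_pos_of_nat (n := ψ n))).trans_right (hwx (ψ n)))
    refine Relation.TransGen.head' (b := z) ?_ (Relation.ReflTransGen.mono hmono _ _ hzx)
    have h3 : dist (φ 1 y) (φ 1 (w (ψ n) 0)) < ε / 2 := Metric.mem_ball'.1 hn1
    have h4 : dist (φ 1 (w (ψ n) 0)) z < 1 / ((ψ n : ℝ) + 1) := hz
    exact (dist_triangle _ _ _).trans_lt (by linarith)

end Isolated


/-! ### Integrals of cocycles along trajectories -/

section Integrals

theorem exists_fine_partition {a b δ : ℝ} (hab : a ≤ b) (hδ : 0 < δ) :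
    ∃ (n : ℕ) (t : ℕ → ℝ), Monotone t ∧ t 0 = a ∧ (∀ k, n ≤ k → t k = b) ∧
      ∀ k, t (k + 1) - t k < δ := by
  obtain ⟨n, hn⟩ := exists_nat_ge ((b - a) / (δ / 2))
  rw [div_le_iff₀ (half_pos hδ)] at hn
  refine ⟨n, fun k => min (a + k * (δ / 2)) b, ?_, by simp [hab], ?_, ?_⟩
  · intro i j hij
    have : (i : ℝ) ≤ j := by exact_mod_cast hij
    exact min_le_min_right b (by nlinarith)
  · intro k hk
    have : (n : ℝ) ≤ k := by exact_mod_cast hk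
    exact min_eq_right (by nlinarith)
  · intro k
    rcases le_total (a + k * (δ / 2)) b with h | h
    · have h1 := min_le_left (a + ((k + 1 : ℕ) : ℝ) * (δ / 2)) b
      simp only [min_eq_left h]
      push_cast at h1 ⊢
      linarith
    · have h1 := min_le_right (a + ((k + 1 : ℕ) : ℝ) * (δ / 2)) b
      simp only [min_eq_right h]
      linarith

theorem HasCurveIntegral.add {X : Type*} {α : X → X → ℝ} {γ : ℝ → X} {a b c I J L : ℝ} (hab : a ≤ b)
    (hbc : b ≤ c) (hI : HasCurveIntegral α γ a b I) (hJ : HasCurveIntegral α γ b c J)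
    (hL : HasCurveIntegral α γ a c L) : I + J = L := by
  obtain ⟨δ₁, hδ₁, h₁⟩ := hI
  obtain ⟨δ₂, hδ₂, h₂⟩ := hJ
  obtain ⟨δ₃, hδ₃, h₃⟩ := hL
  obtain ⟨n, t, htm, ht0, htn, ht⟩ := exists_fine_partition hab (lt_min hδ₁ hδ₃)
  obtain ⟨m, s, hsm, hs0, hsm', hs⟩ := exists_fine_partition hbc (lt_min hδ₂ hδ₃)
  -- Concatenation in one formula: for `k ≤ n` the truncated `k - n` is 0 and `s 0 = b`; for `k ≥ n`
  -- the value `t k = b` cancels.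
  let w : ℕ → ℝ := fun k => t k + (s (k - n) - b)
  have hw₁ : ∀ k ≤ n, w k = t k := by
    intro k hk
    simp [w, Nat.sub_eq_zero_of_le hk, hs0]
  have hw₂ : ∀ k, w (n + k) = s k := by
    intro k
    simp [w, htn (n + k) (Nat.le_add_right n k)]
  have hwm : Monotone w := by
    intro i j hij
    have h1 := htm hij
    have h2 := hsm (Nat.sub_le_sub_right hij n)
    simp only [w]
    linarith
  have hstep : ∀ k < n + m, w (k + 1) - w k < δ₃ := by
    intro k _
    rcases lt_or_ge k n with hk | hk
    · rw [hw₁ k hk.le, hw₁ (k + 1) hk]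
      exact (ht k).trans_le (min_le_right _ _)
    · obtain ⟨j, rfl⟩ := Nat.exists_eq_add_of_le hk
      rw [add_assoc, hw₂, hw₂]
      exact (hs j).trans_le (min_le_right _ _)
  rw [← h₃ (n + m) w hwm (by rw [hw₁ 0 (Nat.zero_le n), ht0]) (by rw [hw₂, hsm' m le_rfl]) hstep,
    Finset.sum_range_add,
    ← h₁ n t htm ht0 (htn n le_rfl) fun k _ => (ht k).trans_le (min_le_left _ _),
    ← h₂ m s hsm hs0 (hsm' m le_rfl) fun k _ => (hs k).trans_le (min_le_left _ _)]
  congr 1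
  · refine Finset.sum_congr rfl fun k hk => ?_
    have hk := Finset.mem_range.1 hk
    rw [hw₁ k hk.le, hw₁ (k + 1) hk]
  · refine Finset.sum_congr rfl fun k _ => ?_
    rw [add_assoc, hw₂, hw₂]

variable {X : Type*} [MetricSpace X] {φ : Flow ℝ X} {α : X → X → ℝ}

theorem IsContinuousCocycle.self_eq_zero (hα : IsContinuousCocycle α) (x : X) : α x x = 0 := by
  obtain ⟨ε, hε, hc⟩ := hα.closed
  have := hc x x x (by simpa) (by simpa) (by simpa)
  linarith

theorem hasCurveIntegral_trajectoryIntegral (hα : IsContinuousCocycle α) (x : X) (a b : ℝ) :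
    HasCurveIntegral α (fun t => φ t x) a b (trajectoryIntegral φ α x a b) :=
  hasCurveIntegral_curveIntegral hα (continuous_orbit φ x) a b

theorem trajectoryIntegral_add (hα : IsContinuousCocycle α) (x : X) {a b c : ℝ} (hab : a ≤ b)
    (hbc : b ≤ c) : trajectoryIntegral φ α x a b + trajectoryIntegral φ α x b c =
      trajectoryIntegral φ α x a c :=
  HasCurveIntegral.add hab hbc (hasCurveIntegral_trajectoryIntegral hα x a b)
    (hasCurveIntegral_trajectoryIntegral hα x b c) (hasCurveIntegral_trajectoryIntegral hα x a c)

theorem trajectoryIntegral_shift (hα : IsContinuousCocycle α) (x : X) (s : ℝ) {a b : ℝ}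
    (hab : a ≤ b) : trajectoryIntegral φ α (φ s x) a b =
      trajectoryIntegral φ α x (a + s) (b + s) := by
  refine (hasCurveIntegral_trajectoryIntegral hα (φ s x) a b).eq hab ?_
  obtain ⟨δ, hδ, h⟩ := hasCurveIntegral_trajectoryIntegral (φ := φ) hα x (a + s) (b + s)
  refine ⟨δ, hδ, fun n t htm ht0 htn ht => ?_⟩
  rw [← h n (fun k => t k + s) (fun i j hij => add_le_add_left (htm hij) s) (by rw [ht0])
    (by rw [htn]) (fun k hk => by simpa using ht k hk)]
  simp only [φ.map_add]

theorem trajectoryIntegral_eq_sub (hα : IsContinuousCocycle α) {β : X → ℝ} {S : Set X}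
    (hβ : IsPrimitiveOn α β S) {x : X} {a b : ℝ} (hab : a ≤ b)
    (hS : ∀ u ∈ Icc a b, φ u x ∈ S) :
    trajectoryIntegral φ α x a b = β (φ b x) - β (φ a x) := by
  refine (hasCurveIntegral_trajectoryIntegral hα x a b).eq hab ?_
  obtain ⟨-, ε, hε, h⟩ := hβ
  have hu : UniformContinuousOn (fun t => φ t x) (Icc a b) :=
    isCompact_Icc.uniformContinuousOn_of_continuous (continuous_orbit φ x).continuousOn
  obtain ⟨δ, hδ, hd⟩ := Metric.uniformContinuousOn_iff.1 hu ε hε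
  refine ⟨δ, hδ, fun n t htm ht0 htn ht => ?_⟩
  have hmem : ∀ k ≤ n, t k ∈ Icc a b := fun k hk =>
    ⟨ht0 ▸ htm (Nat.zero_le k), htn ▸ htm hk⟩
  rw [Finset.sum_congr rfl (g := fun k => β (φ (t (k + 1)) x) - β (φ (t k) x)),
    Finset.sum_range_sub (fun k => β (φ (t k) x)), ht0, htn]
  intro k hk
  have hk := Finset.mem_range.1 hk
  refine h _ (hS _ (hmem k hk.le)) _ (hS _ (hmem (k + 1) hk))
    (hd _ (hmem k hk.le) _ (hmem (k + 1) hk) ?_)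
  rw [dist_comm, Real.dist_eq, abs_of_nonneg (sub_nonneg.2 (htm (Nat.le_succ k)))]
  exact ht k hk

/-- Integrals over trajectory pieces of short duration are uniformly small. -/
theorem exists_trajectoryIntegral_lt [CompactSpace X] (hα : IsContinuousCocycle α) {ρ : ℝ}
    (hρ : 0 < ρ) : ∃ η > 0, ∀ x a b, a ≤ b → b - a < η → trajectoryIntegral φ α x a b < ρ := by
  obtain ⟨ε₁, hε₁, hcont⟩ := hα.continuous_near
  obtain ⟨ε₂, hε₂, hclosed⟩ := hα.closed
  have hopen : IsOpen {p : X × X | dist p.1 p.2 < ε₁} := isOpen_lt continuous_dist continuous_const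
  have hsmall : {p : X × X | α p.1 p.2 < ρ} ∈ uniformity X := by
    rw [← nhdsSet_diagonal_eq_uniformity, mem_nhdsSet_iff_forall]
    rintro ⟨x, y⟩ (hxy : x = y)
    subst hxy
    refine (hcont.continuousAt (hopen.mem_nhds (by simpa using hε₁))).eventually_lt_const ?_
    simpa [hα.self_eq_zero] using hρ
  obtain ⟨ε₃, hε₃, hlt⟩ := Metric.mem_uniformity_dist.1 hsmall
  have hm : 0 < min ε₂ ε₃ := lt_min hε₂ hε₃
  have hev : ∀ᶠ u : ℝ in 𝓝 0, ∀ z ∈ (univ : Set X), dist z (φ u z) < min ε₂ ε₃ := by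
    refine isCompact_univ.eventually_forall_of_forall_eventually fun z _ => ?_
    have hc : ContinuousAt (fun q : ℝ × X => dist q.2 (φ q.1 q.2)) (0, z) :=
      (continuous_snd.dist (φ.continuous continuous_fst continuous_snd)).continuousAt
    exact hc.eventually_lt_const (by simpa using hm)
  obtain ⟨η, hη, hball⟩ := Metric.eventually_nhds_iff.1 hev
  have hdist : ∀ x u v, |v - u| < η → dist (φ u x) (φ v x) < min ε₂ ε₃ := by
    intro x u v huv
    have := hball (y := v - u) (by simpa [Real.dist_eq] using huv) (φ u x) (mem_univ _)
    rwa [← φ.map_add, sub_add_cancel] at this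
  refine ⟨η, hη, fun x a b hab hb => ?_⟩
  -- On a short piece all points are mutually close, so the sum telescopes to the value of `α` at
  -- the endpoints, which is small because `α` vanishes on the diagonal.
  have hI : HasCurveIntegral α (fun t => φ t x) a b (α (φ a x) (φ b x)) := by
    refine ⟨1, one_pos, fun n t htm ht0 htn _ => ?_⟩
    have hmem : ∀ k ≤ n, t k ∈ Icc a b := fun k hk =>
      ⟨ht0 ▸ htm (Nat.zero_le k), htn ▸ htm hk⟩
    have hsum : ∀ m ≤ n, ∑ k ∈ Finset.range m, α (φ (t k) x) (φ (t (k + 1)) x) =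
        α (φ a x) (φ (t m) x) := by
      intro m hmn
      induction m with
      | zero => simp [ht0, hα.self_eq_zero]
      | succ m ih =>
        have h1 := hmem m (Nat.le_of_succ_le hmn)
        have h2 := hmem (m + 1) hmn
        have h3 := htm (Nat.le_succ m)
        have hclose : ∀ u v, a ≤ u → u ≤ v → v ≤ b → dist (φ u x) (φ v x) < ε₂ := by
          intro u v hau huv hvb
          refine (hdist x u v ?_).trans_le (min_le_left _ _)
          rw [abs_of_nonneg (sub_nonneg.2 huv)]
          linarith
        have := hclosed _ _ _ (hclose a (t m) le_rfl h1.1 h1.2)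
          (hclose (t m) (t (m + 1)) h1.1 h3 h2.2) (hclose a (t (m + 1)) le_rfl h2.1 h2.2)
        rw [Finset.sum_range_succ, ih (Nat.le_of_succ_le hmn)]
        linarith
    rw [hsum n le_rfl, htn]
  rw [(hasCurveIntegral_trajectoryIntegral hα x a b).eq hab hI]
  refine hlt ((hdist x a b ?_).trans_le (min_le_right _ _))
  rwa [abs_of_nonneg (sub_nonneg.2 hab)]

end Integrals

/-! ### Flow neighbourhoods -/

section FlowNeighborhoods

variable {X : Type*} [MetricSpace X]

theorem flowNeighborhood_subset (φ : Flow ℝ X) (A V : Set X) (r : ℝ) :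
    flowNeighborhood φ A V r ⊆ V := by
  rintro x ⟨t, -, h⟩
  simpa using h 0 left_mem_uIcc

theorem mem_flowNeighborhood_of_dist_le (φ : Flow ℝ X) {V : Set X} {p x : X} {r : ℝ}
    (hV : Metric.cthickening r {p} ⊆ V) (hx : dist x p ≤ r) :
    x ∈ flowNeighborhood φ {p} V r := by
  have hr : x ∈ Metric.cthickening r {p} := by
    rw [Metric.cthickening_singleton _ (dist_nonneg.trans hx)]
    exact hx
  exact ⟨0, by simpa using hr, fun u hu => by simp_all [hV hr]⟩

/-- For a limit of points with hitting times `t n`, a bounded subsequence of times yields a hitting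
time of the limit. Otherwise a half-orbit of the limit stays in `V`, so it converges to `p` by
isolation and hits the neighbourhood in finite time. -/
theorem isClosed_flowNeighborhood [CompactSpace X] (φ : Flow ℝ X) {V : Set X} {p : X} {r : ℝ}
    (hV : IsIsolatingNeighborhood φ {p} V) (hr : 0 < r) :
    IsClosed (flowNeighborhood φ {p} V r) := by
  obtain ⟨hVc, -, hinv⟩ := hV
  have hball : Metric.cthickening r {p} ∈ 𝓝 p := by
    rw [Metric.cthickening_singleton _ hr.le]
    exact Metric.closedBall_mem_nhds p hr
  refine isClosed_of_closure_subset fun x hx => ?_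
  obtain ⟨z, hz, hzx⟩ := mem_closure_iff_seq_limit.1 hx
  choose t ht htV using hz
  by_cases hb : ∃ C : ℝ, ∃ᶠ n in atTop, t n ∈ Icc (-C) C
  · obtain ⟨C, hC⟩ := hb
    obtain ⟨τ, -, ψ, hψ, hτ⟩ := isCompact_Icc.tendsto_subseq' hC
    have hzψ := hzx.comp hψ.tendsto_atTop
    -- Writing the times between 0 and `τ` as `θ * τ` treats both signs of `τ` together.
    have hlim : ∀ θ : ℝ, Tendsto (fun n => φ (θ * t (ψ n)) (z (ψ n))) atTop
        (𝓝 (φ (θ * τ) x)) := by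
      intro θ
      have hc : Continuous fun q : ℝ × X => φ (θ * q.1) q.2 :=
        φ.continuous (continuous_const.mul continuous_fst) continuous_snd
      exact (hc.tendsto (τ, x)).comp (hτ.prodMk_nhds hzψ)
    refine ⟨τ, ?_, fun u hu => ?_⟩
    · have := hlim 1
      simp only [one_mul] at this
      exact Metric.isClosed_cthickening.mem_of_tendsto this
        (Eventually.of_forall fun n => ht (ψ n))
    · rw [← segment_eq_uIcc, segment_eq_image] at hu
      obtain ⟨θ, hθ, rfl⟩ := hu
      simp only [smul_eq_mul, mul_zero, zero_add]
      refine hVc.mem_of_tendsto (hlim θ) (Eventually.of_forall fun n => htV _ _ ?_)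
      rw [← segment_eq_uIcc, segment_eq_image]
      exact ⟨θ, hθ, by simp⟩
  · push Not at hb
    have hlim : ∀ u, Tendsto (fun n => φ u (z n)) atTop (𝓝 (φ u x)) := fun u =>
      ((continuous_time φ u).tendsto x).comp hzx
    by_cases hpos : ∃ᶠ n in atTop, 0 ≤ t n
    · have hfwd : ∀ u, 0 ≤ u → φ u x ∈ V := by
        intro u hu
        refine hVc.mem_of_frequently_of_tendsto ((hpos.and_eventually (hb u)).mono ?_) (hlim u)
        rintro n ⟨h1, h2⟩
        refine htV n u ?_
        rw [uIcc_of_le h1]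
        refine ⟨hu, ?_⟩
        by_contra! h3
        exact h2 ⟨by linarith, h3.le⟩
      have hlim' : Tendsto (fun t => φ t x) atTop (𝓝 p) := by
        refine tendsto_of_eventually_mem_isolating φ hVc hinv fun s => ?_
        filter_upwards [eventually_ge_atTop (-s)] with t ht
        exact hfwd _ (by linarith)
      obtain ⟨s, hs, hs0⟩ := ((hlim'.eventually hball).and (eventually_ge_atTop 0)).exists
      refine ⟨s, hs, fun u hu => hfwd u ?_⟩
      rw [uIcc_of_le hs0] at hu
      exact hu.1
    · have hneg : ∃ᶠ n in atTop, t n ≤ 0 := by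
        rw [not_frequently] at hpos
        exact (hpos.mono fun n hn => (not_le.1 hn).le).frequently
      have hbwd : ∀ u, u ≤ 0 → φ u x ∈ V := by
        intro u hu
        refine hVc.mem_of_frequently_of_tendsto ((hneg.and_eventually (hb (-u))).mono ?_) (hlim u)
        rintro n ⟨h1, h2⟩
        refine htV n u ?_
        rw [uIcc_of_ge h1]
        refine ⟨?_, hu⟩
        by_contra! h3
        exact h2 ⟨by linarith, by linarith⟩
      have hlim' : Tendsto (fun t => φ t x) atBot (𝓝 p) := by
        refine tendsto_of_eventually_mem_isolating φ hVc hinv fun s => ?_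
        filter_upwards [eventually_le_atBot (-s)] with t ht
        exact hbwd _ (by linarith)
      obtain ⟨s, hs, hs0⟩ := ((hlim'.eventually hball).and (eventually_le_atBot 0)).exists
      refine ⟨s, hs, fun u hu => hbwd u ?_⟩
      rw [uIcc_of_ge hs0] at hu
      exact hu.2

theorem mem_of_isPreconnected_of_mem {Y ι : Type*} [TopologicalSpace Y] [Finite ι]
    {K : ι → Set X} (hK : ∀ i, IsClosed (K i)) (hd : Pairwise fun i j => Disjoint (K i) (K j))
    {f : Y → X} (hf : Continuous f) {S : Set Y} (hS : IsPreconnected S)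
    (hSK : ∀ u ∈ S, f u ∈ ⋃ i, K i) {s : Y} (hs : s ∈ S) {i : ι} (hsi : f s ∈ K i) :
    ∀ u ∈ S, f u ∈ K i := by
  intro u hu
  by_contra hui
  have hother : ∀ v ∈ S, f v ∉ K i → f v ∈ ⋃ j : {j // j ≠ i}, K j := by
    intro v hv hvi
    obtain ⟨j, hj⟩ := mem_iUnion.1 (hSK v hv)
    refine mem_iUnion.2 ⟨⟨j, ?_⟩, hj⟩
    rintro rfl
    exact hvi hj
  obtain ⟨v, -, hv1, hv2⟩ := isPreconnected_closed_iff.1 hS (f ⁻¹' K i)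
    (f ⁻¹' ⋃ j : {j // j ≠ i}, K j) ((hK i).preimage hf)
    ((isClosed_iUnion_of_finite fun j : {j // j ≠ i} => hK j).preimage hf)
    (fun v hv => or_iff_not_imp_left.2 (hother v hv)) ⟨s, hs, hsi⟩ ⟨u, hu, hother u hu hui⟩
  obtain ⟨⟨j, hj⟩, hvj⟩ := mem_iUnion.1 hv2
  exact (hd hj).le_bot ⟨hvj, hv1⟩

end FlowNeighborhoods

/-! ### Excursions -/

section Excursions

variable {X : Type*} [MetricSpace X]

/-- A cocycle is carried by a flow, relative to a finite family of disjoint closed sets `K i`, if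
its variation on each `K i` is at most `lam * ρ` and its integral grows by at least `ρ` on each
excursion from the union of the `K i`. -/
structure IsCarriedBy {ι : Type*} (φ : Flow ℝ X) (α : X → X → ℝ) (K : ι → Set X)
    (β : ι → X → ℝ) (T₀ ρ lam : ℝ) : Prop where
  cocycle : IsContinuousCocycle α
  isClosed : ∀ i, IsClosed (K i)
  disjoint : Pairwise fun i j => Disjoint (K i) (K j)
  time_pos : 0 < T₀
  gain_pos : 0 < ρ
  lam_lt_one : lam < 1
  primitive : ∀ i, IsPrimitiveOn α (β i) (K i)
  oscillation : ∀ i, ∀ x ∈ K i, ∀ y ∈ K i, |β i y - β i x| ≤ lam * ρ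
  bounded : ∀ x a b, IsBoundedTrajectory φ (⋃ i, K i) x a b → ρ ≤ trajectoryIntegral φ α x a b
  unbounded : ∀ x a, IsInUnboundedTrajectory φ (⋃ i, K i) x a (a + T₀) →
    ρ ≤ trajectoryIntegral φ α x a (a + T₀)

variable {ι : Type*} {φ : Flow ℝ X} {α : X → X → ℝ} {K : ι → Set X}
  {β : ι → X → ℝ} {T₀ ρ lam : ℝ}

/-- The endpoints are the last time in `S` before `u` and the first one after it. -/
theorem exists_isBoundedTrajectory {S : Set X} (hS : IsClosed S) {x : X} {a b u : ℝ}
    (hau : a ≤ u) (hub : u ≤ b) (ha : φ a x ∈ S) (hb : φ b x ∈ S) (hu : φ u x ∉ S) :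
    ∃ s t, a ≤ s ∧ s < u ∧ u < t ∧ t ≤ b ∧ IsBoundedTrajectory φ S x s t := by
  have hcl : IsClosed {w | φ w x ∈ S} := hS.preimage (continuous_orbit φ x)
  obtain ⟨s, ⟨hs, hsS⟩, hsmax⟩ := (isCompact_Icc.inter_right hcl).exists_isGreatest
    (s := Icc a u ∩ {w | φ w x ∈ S}) ⟨a, ⟨le_rfl, hau⟩, ha⟩
  obtain ⟨t, ⟨ht, htS⟩, htmin⟩ := (isCompact_Icc.inter_right hcl).exists_isLeast
    (s := Icc u b ∩ {w | φ w x ∈ S}) ⟨b, ⟨hub, le_rfl⟩, hb⟩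
  have hsu : s < u := lt_of_le_of_ne hs.2 (by rintro rfl; exact hu hsS)
  have hut : u < t := lt_of_le_of_ne ht.1 (by rintro rfl; exact hu htS)
  refine ⟨s, t, hs.1, hsu, hut, ht.2, hsu.trans hut, hsS, htS, fun w hw hwS => ?_⟩
  rcases le_total w u with h | h
  · exact hw.1.not_ge (hsmax ⟨⟨hs.1.trans hw.1.le, h⟩, hwS⟩)
  · exact hw.2.not_ge (htmin ⟨⟨h, hw.2.le.trans ht.2⟩, hwS⟩)

theorem IsCarriedBy.oscillation_le (h : IsCarriedBy φ α K β T₀ ρ lam) {x : X} {a b : ℝ} {i : ι}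
    (hab : a ≤ b) (hK : ∀ u ∈ Icc a b, φ u x ∈ K i) :
    -(lam * ρ) ≤ trajectoryIntegral φ α x a b := by
  rw [trajectoryIntegral_eq_sub h.cocycle (h.primitive i) hab hK]
  exact (abs_le.1 (h.oscillation i _ (hK a ⟨le_rfl, hab⟩) _ (hK b ⟨hab, le_rfl⟩))).1

variable [Finite ι]

/-- A piece of trajectory from `K i` to `K j` either stays in `K i`, or consists of a first part in
`K i`, a middle part which contributes at least `ρ` to the integral, and a last part in `K j`. -/
theorem IsCarriedBy.stays_or_gains [CompactSpace X] (h : IsCarriedBy φ α K β T₀ ρ lam) {x : X}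
    {a b : ℝ} {i j : ι} (hab : a ≤ b) (ha : φ a x ∈ K i) (hb : φ b x ∈ K j) :
    (i = j ∧ ∀ u ∈ Icc a b, φ u x ∈ K i) ∨
    ∃ s t, a ≤ s ∧ s ≤ t ∧ t ≤ b ∧ (∀ u ∈ Icc a s, φ u x ∈ K i) ∧
      (∀ u ∈ Icc t b, φ u x ∈ K j) ∧ ρ ≤ trajectoryIntegral φ α x s t := by
  -- An excursion gains at least `ρ`, so it lasts at least `η`. This permits induction on a bound `n
  -- * η` for the duration.
  obtain ⟨η, hη, hshort⟩ := exists_trajectoryIntegral_lt (φ := φ) h.cocycle h.gain_pos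
  obtain ⟨n, hn⟩ := exists_nat_ge ((b - a) / η)
  rw [div_le_iff₀ hη] at hn
  have hKc : IsClosed (⋃ i, K i) := isClosed_iUnion_of_finite h.isClosed
  have hρ := h.gain_pos
  have hlam := h.lam_lt_one
  have hosc : ∀ k a b, a ≤ b → (∀ u ∈ Icc a b, φ u x ∈ K k) →
      -ρ ≤ trajectoryIntegral φ α x a b := by
    intro k a b hab hk
    have h1 := h.oscillation_le hab hk
    have h2 := mul_lt_mul_of_pos_right hlam hρ
    linarith
  induction n generalizing a b i j with
  | zero =>
    have : a = b := by
      simp only [Nat.cast_zero, zero_mul] at hn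
      linarith
    subst this
    refine Or.inl ⟨?_, fun u hu => by rwa [le_antisymm hu.2 hu.1]⟩
    by_contra hij
    exact (h.disjoint hij).le_bot ⟨ha, hb⟩
  | succ n ih =>
    by_cases hall : ∀ u ∈ Icc a b, φ u x ∈ ⋃ i, K i
    · have hi := mem_of_isPreconnected_of_mem h.isClosed h.disjoint (continuous_orbit φ x)
        isPreconnected_Icc hall (left_mem_Icc.2 hab) ha
      refine Or.inl ⟨?_, hi⟩
      by_contra hij
      exact (h.disjoint hij).le_bot ⟨hi b (right_mem_Icc.2 hab), hb⟩
    · push Not at hall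
      obtain ⟨u, hu, huK⟩ := hall
      obtain ⟨s, t, has, hsu, hut, htb, hst⟩ := exists_isBoundedTrajectory hKc hu.1 hu.2
        (mem_iUnion_of_mem i ha) (mem_iUnion_of_mem j hb) huK
      have hgain := h.bounded _ _ _ hst
      have hlen : η ≤ t - s := by
        by_contra! hlt
        exact (hshort x s t hst.1.le hlt).not_ge hgain
      obtain ⟨k, hk⟩ := mem_iUnion.1 hst.2.1
      obtain ⟨l, hl⟩ := mem_iUnion.1 hst.2.2.1
      push_cast at hn
      -- If the part before the excursion already has a gaining middle, the visit between the two
      -- gains costs at most `ρ`, so the merged middle still gains `ρ`. The part after the excursion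
      -- is merged in the same way.
      obtain ⟨s', has', hss', hs'K, hgain'⟩ : ∃ s', a ≤ s' ∧ s' ≤ s ∧
          (∀ u ∈ Icc a s', φ u x ∈ K i) ∧ ρ ≤ trajectoryIntegral φ α x s' t := by
        rcases ih has ha hk (by linarith) with ⟨rfl, hstay⟩ | ⟨s', t', h1, h2, h3, h4, h5, h6⟩
        · exact ⟨s, has, le_rfl, hstay, hgain⟩
        · refine ⟨s', h1, h2.trans h3, h4, ?_⟩
          have := hosc k t' s h3 h5
          rw [← trajectoryIntegral_add h.cocycle x (h2.trans h3) hst.1.le,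
            ← trajectoryIntegral_add h.cocycle x h2 h3]
          linarith
      rcases ih htb hl hb (by linarith) with ⟨rfl, hstay⟩ | ⟨s'', t'', h1, h2, h3, h4, h5, h6⟩
      · exact Or.inr ⟨s', t, has', by linarith, htb, hs'K, hstay, hgain'⟩
      · refine Or.inr ⟨s', t'', has', by linarith, h3, hs'K, h5, ?_⟩
        have := hosc l t s'' h1 h4
        rw [← trajectoryIntegral_add h.cocycle x (b := t) (by linarith) (h1.trans h2),
          ← trajectoryIntegral_add h.cocycle x h1 h2]
        linarith

/-- The first and last parts cost at most `lam * ρ` each, and the gain in the middle pays for one of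
them. -/
theorem IsCarriedBy.neg_le_trajectoryIntegral [CompactSpace X]
    (h : IsCarriedBy φ α K β T₀ ρ lam) {x : X} {a b : ℝ} (hab : a ≤ b)
    (ha : φ a x ∈ ⋃ i, K i) (hb : φ b x ∈ ⋃ i, K i) :
    -(lam * ρ) ≤ trajectoryIntegral φ α x a b := by
  obtain ⟨i, hi⟩ := mem_iUnion.1 ha
  obtain ⟨j, hj⟩ := mem_iUnion.1 hb
  rcases h.stays_or_gains hab hi hj with ⟨-, hK⟩ | ⟨s, t, h1, h2, h3, h4, h5, h6⟩
  · exact h.oscillation_le hab hK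
  · have h7 := h.oscillation_le h1 h4
    have h8 := h.oscillation_le h3 h5
    have := mul_lt_mul_of_pos_right h.lam_lt_one h.gain_pos
    rw [← trajectoryIntegral_add h.cocycle x (h1.trans h2) h3,
      ← trajectoryIntegral_add h.cocycle x h1 h2]
    linarith

/-- If the integrals over long pieces of a trajectory are bounded from above, then the trajectory
ends up in one of the sets `K i`. -/
theorem IsCarriedBy.eventually_mem [CompactSpace X] (h : IsCarriedBy φ α K β T₀ ρ lam) {x : X}
    {M T : ℝ} (hM : ∀ a b, 0 ≤ a → T ≤ b - a → trajectoryIntegral φ α x a b < M) :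
    ∃ i, ∀ᶠ t in atTop, φ t x ∈ K i := by
  have hρ := h.gain_pos
  have hT₀ := h.time_pos
  have hκ : 0 < ρ - lam * ρ := sub_pos.2 (by
    simpa using mul_lt_mul_of_pos_right h.lam_lt_one h.gain_pos)
  have hKc : IsClosed (⋃ i, K i) := isClosed_iUnion_of_finite h.isClosed
  -- A trajectory that stays outside from some time on would gain `ρ` in every period `T₀`.
  have hrec : ∀ a, ∃ t, a ≤ t ∧ φ t x ∈ ⋃ i, K i := by
    by_contra! hout
    obtain ⟨a, ha⟩ := hout
    set c := max a 0 with hc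
    have hgrow : ∀ k : ℕ, k * ρ ≤ trajectoryIntegral φ α x c (c + k * T₀) := by
      intro k
      induction k with
      | zero =>
        have := trajectoryIntegral_add (φ := φ) h.cocycle x (le_refl c) (le_refl c)
        simp only [Nat.cast_zero, zero_mul, add_zero]
        linarith
      | succ k ih =>
        have hk : c ≤ c + k * T₀ := le_add_of_nonneg_right (by positivity)
        have h1 := h.unbounded x (c + k * T₀) ⟨by linarith, Or.inl fun t ht =>
          ha t ((le_max_left a 0).trans (hk.trans ht))⟩
        rw [show c + ((k + 1 : ℕ) : ℝ) * T₀ = c + k * T₀ + T₀ by push_cast; ring,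
          ← trajectoryIntegral_add h.cocycle x hk (by linarith)]
        push_cast
        linarith
    obtain ⟨k₁, hk₁⟩ := exists_nat_ge (M / ρ)
    obtain ⟨k₂, hk₂⟩ := exists_nat_ge (T / T₀)
    rw [div_le_iff₀ hρ] at hk₁
    rw [div_le_iff₀ hT₀] at hk₂
    have h1 := hgrow (k₁ + k₂)
    have h2 := hM c (c + (k₁ + k₂ : ℕ) * T₀) (le_max_right a 0) (by push_cast; nlinarith)
    push_cast at h1 h2
    have : 0 ≤ (k₂ : ℝ) * ρ := by positivity
    linarith
  have hin : ∃ a, ∀ t, a ≤ t → φ t x ∈ ⋃ i, K i := by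
    by_contra! hout
    obtain ⟨c, hc, hcK⟩ := hrec 0
    -- Each further excursion nets `ρ - lam * ρ`, whatever happens between excursions. The initial
    -- piece is chosen long enough for the bound `hM` to apply.
    have hgrow : ∀ k : ℕ, ∃ t, c ≤ t ∧ T ≤ t - c ∧ φ t x ∈ ⋃ i, K i ∧
        k * (ρ - lam * ρ) - lam * ρ ≤ trajectoryIntegral φ α x c t := by
      intro k
      induction k with
      | zero =>
        obtain ⟨t, ht, htK⟩ := hrec (c + max T 0)
        have h1 := le_max_left T 0
        have h2 := le_max_right T 0
        refine ⟨t, by linarith, by linarith, htK, ?_⟩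
        have := h.neg_le_trajectoryIntegral (by linarith : c ≤ t) hcK htK
        simpa using this
      | succ k ih =>
        obtain ⟨t, hct, hTt, htK, ht⟩ := ih
        obtain ⟨u, htu, hu⟩ := hout t
        obtain ⟨v, huv, hv⟩ := hrec u
        obtain ⟨s, w, hts, hsu, huw, -, hsw⟩ := exists_isBoundedTrajectory hKc htu huv htK hv hu
        refine ⟨w, by linarith, by linarith, hsw.2.2.1, ?_⟩
        have h1 := h.bounded _ _ _ hsw
        have h2 := h.neg_le_trajectoryIntegral hts htK hsw.2.1
        rw [← trajectoryIntegral_add h.cocycle x (hct.trans hts) hsw.1.le,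
          ← trajectoryIntegral_add h.cocycle x hct hts]
        push_cast
        linarith
    obtain ⟨k, hk⟩ := exists_nat_ge ((M + lam * ρ) / (ρ - lam * ρ))
    rw [div_le_iff₀ hκ] at hk
    obtain ⟨t, -, hTt, -, ht⟩ := hgrow k
    have := hM c t hc hTt
    linarith
  obtain ⟨a, ha⟩ := hin
  obtain ⟨i, hi⟩ := mem_iUnion.1 (ha a le_rfl)
  refine ⟨i, ?_⟩
  filter_upwards [eventually_ge_atTop a] with t ht
  exact mem_of_isPreconnected_of_mem h.isClosed h.disjoint (continuous_orbit φ x)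
    isPreconnected_Ici ha self_mem_Ici hi t ht

end Excursions


/-! ### Connecting orbits and chains -/

section Connections

variable {X : Type*} [MetricSpace X]

/-- The connecting orbit is truncated close to its two limits. It passes outside `⋃ i, K i`, so the
first alternative of `stays_or_gains` is impossible. -/
theorem IsCarriedBy.exists_long_connection {ι : Type*} [Finite ι] [CompactSpace X] {φ : Flow ℝ X}
    {α : X → X → ℝ} {K : ι → Set X} {β : ι → X → ℝ} {T₀ ρ lam : ℝ}
    (h : IsCarriedBy φ α K β T₀ ρ lam) {p : ι → X} (hpK : ∀ i, K i ∈ 𝓝 (p i)) {y : X} {i j : ι}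
    (hi : Tendsto (fun t => φ t y) atBot (𝓝 (p i)))
    (hj : Tendsto (fun t => φ t y) atTop (𝓝 (p j)))
    (hy : ∃ u, φ u y ∉ ⋃ i, K i) {δ : ℝ} (hδ : 0 < δ) (T : ℝ) :
    ∃ x τ s t, T ≤ τ ∧ 0 ≤ s ∧ s ≤ t ∧ t ≤ τ ∧ dist x (p i) < δ ∧ dist (φ τ x) (p j) < δ ∧
      (∀ u ∈ Icc 0 s, φ u x ∈ K i) ∧ (∀ u ∈ Icc t τ, φ u x ∈ K j) ∧
      ρ ≤ trajectoryIntegral φ α x s t := by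
  obtain ⟨u, hu⟩ := hy
  obtain ⟨a, ⟨haδ, haK⟩, hau⟩ := (((hi.eventually (Metric.ball_mem_nhds _ hδ)).and
    (hi.eventually (hpK i))).and (eventually_le_atBot u)).exists
  obtain ⟨b, ⟨hbδ, hbK⟩, hub⟩ := (((hj.eventually (Metric.ball_mem_nhds _ hδ)).and
    (hj.eventually (hpK j))).and (eventually_ge_atTop (max u (a + T)))).exists
  have hub' := (le_max_left _ _).trans hub
  have hTb := (le_max_right _ _).trans hub
  rcases h.stays_or_gains (hau.trans hub') haK hbK with ⟨-, hK⟩ | ⟨s, t, h1, h2, h3, h4, h5, h6⟩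
  · exact absurd (mem_iUnion_of_mem i (hK u ⟨hau, hub'⟩)) hu
  · refine ⟨φ a y, b - a, s - a, t - a, by linarith, by linarith, by linarith, by linarith,
      haδ, ?_, fun v hv => ?_, fun v hv => ?_, ?_⟩
    · rw [← φ.map_add, sub_add_cancel]
      exact hbδ
    · rw [← φ.map_add]
      exact h4 _ ⟨by linarith [hv.1], by linarith [hv.2]⟩
    · rw [← φ.map_add]
      exact h5 _ ⟨by linarith [hv.1], by linarith [hv.2]⟩
    · rw [trajectoryIntegral_shift h.cocycle _ _ (by linarith), sub_add_cancel, sub_add_cancel]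
      exact h6

/-- Along an infinite sequence of connecting orbits there are pseudo-orbits with small jumps and
arbitrarily large integrals. -/
theorem IsCarriedBy.exists_large_chain {ι : Type*} [Finite ι] [CompactSpace X] {φ : Flow ℝ X}
    {α : X → X → ℝ} {K : ι → Set X} {β : ι → X → ℝ} {T₀ ρ lam : ℝ}
    (h : IsCarriedBy φ α K β T₀ ρ lam) {p : ι → X} (hpK : ∀ i, K i ∈ 𝓝 (p i)) {i : ℕ → ι}
    {y : ℕ → X} (hbot : ∀ m, Tendsto (fun t => φ t (y m)) atBot (𝓝 (p (i m))))
    (htop : ∀ m, Tendsto (fun t => φ t (y m)) atTop (𝓝 (p (i (m + 1)))))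
    (hy : ∀ m, ∃ u, φ u (y m) ∉ ⋃ i, K i) {δ : ℝ} (hδ : 0 < δ) (T M : ℝ) :
    ∃ (N : ℕ) (x : ℕ → X) (τ : ℕ → ℝ), 0 < N ∧
      (∀ m, T ≤ τ m ∧ dist (φ (τ m) (x m)) (x (m + 1)) < δ) ∧
      M ≤ ∑ m ∈ Finset.range N,
        (trajectoryIntegral φ α (x m) 0 (τ m) + α (φ (τ m) (x m)) (x (m + 1))) := by
  -- Below this scale the primitive on `K k` computes `α` on the jumps near `p k`.
  have hev : ∀ᶠ η : ℝ in 𝓝[>] 0, η < δ ∧ ∀ k, Metric.ball (p k) η ⊆ K k ∧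
      ∀ x ∈ K k, ∀ y ∈ K k, dist x y < 2 * η → α x y = β k y - β k x := by
    refine (eventually_nhdsWithin_of_eventually_nhds (gt_mem_nhds hδ)).and
      (eventually_all.2 fun k => ?_)
    obtain ⟨ε₁, hε₁, h₁⟩ := Metric.mem_nhds_iff.1 (hpK k)
    obtain ⟨-, ε₂, hε₂, h₂⟩ := h.primitive k
    filter_upwards [eventually_nhdsWithin_of_eventually_nhds (gt_mem_nhds hε₁),
      eventually_nhdsWithin_of_eventually_nhds (gt_mem_nhds (half_pos hε₂))] with η hη₁ hη₂
    exact ⟨(Metric.ball_subset_ball hη₁.le).trans h₁,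
      fun x hx y hy hxy => h₂ x hx y hy (by linarith)⟩
  obtain ⟨η, ⟨hηδ, hη⟩, hηpos⟩ := (hev.and self_mem_nhdsWithin).exists
  have hηpos : 0 < η := hηpos
  choose x τ s t hT hs hst htτ hxi hxj hsK htK hgain using fun m =>
    h.exists_long_connection hpK (hbot m) (htop m) (hy m) (half_pos hηpos) T
  have hjump : ∀ m, dist (φ (τ m) (x m)) (x (m + 1)) < η := fun m =>
    (dist_triangle_right _ _ (p (i (m + 1)))).trans_lt (by linarith [hxj m, hxi (m + 1)])
  have hxK : ∀ m, x m ∈ K (i m) := fun m => by simpa using hsK m 0 ⟨le_rfl, hs m⟩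
  have hsK' : ∀ m, φ (s m) (x m) ∈ K (i m) := fun m => hsK m _ ⟨hs m, le_rfl⟩
  have htK' : ∀ m, φ (t m) (x m) ∈ K (i (m + 1)) := fun m => htK m _ ⟨le_rfl, htτ m⟩
  have hτK : ∀ m, φ (τ m) (x m) ∈ K (i (m + 1)) := fun m => htK m _ ⟨htτ m, le_rfl⟩
  have hterm : ∀ m, ρ + (β (i m) (φ (s m) (x m)) - β (i m) (x m)) +
      (β (i (m + 1)) (x (m + 1)) - β (i (m + 1)) (φ (t m) (x m))) ≤
      trajectoryIntegral φ α (x m) 0 (τ m) + α (φ (τ m) (x m)) (x (m + 1)) := by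
    intro m
    have h1 := trajectoryIntegral_eq_sub h.cocycle (h.primitive (i m)) (hs m) (hsK m)
    have h2 := trajectoryIntegral_eq_sub h.cocycle (h.primitive (i (m + 1))) (htτ m) (htK m)
    have h3 := (hη (i (m + 1))).2 _ (hτK m) _ (hxK (m + 1)) (by linarith [hjump m])
    rw [φ.map_zero_apply] at h1
    rw [← trajectoryIntegral_add h.cocycle (x m) ((hs m).trans (hst m)) (htτ m),
      ← trajectoryIntegral_add h.cocycle (x m) (hs m) (hst m), h1, h2, h3]
    linarith [hgain m]
  -- The end of one connection, the jump and the start of the next all lie in the same `K i`, so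
  -- together they cost only one `lam * ρ`. The extra term on the right completes the last such
  -- visit.
  have hsum : ∀ N : ℕ, N * (ρ - lam * ρ) - lam * ρ ≤ ∑ m ∈ Finset.range N,
      (trajectoryIntegral φ α (x m) 0 (τ m) + α (φ (τ m) (x m)) (x (m + 1))) +
      (β (i N) (φ (s N) (x N)) - β (i N) (x N)) := by
    intro N
    induction N with
    | zero => simpa using (abs_le.1 (h.oscillation _ _ (hxK 0) _ (hsK' 0))).1
    | succ N ih =>
      have h1 := (abs_le.1 (h.oscillation _ _ (htK' N) _ (hsK' (N + 1)))).1
      rw [Finset.sum_range_succ]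
      push_cast
      linarith [hterm N]
  have hκ : 0 < ρ - lam * ρ := sub_pos.2 (by
    simpa using mul_lt_mul_of_pos_right h.lam_lt_one h.gain_pos)
  -- One `lam * ρ` is the initial loss in `hsum`, the other comes from dropping its extra term.
  obtain ⟨N, hN⟩ := exists_nat_ge ((M + 2 * (lam * ρ)) / (ρ - lam * ρ))
  rw [div_le_iff₀ hκ] at hN
  refine ⟨N + 1, x, τ, N.succ_pos, fun m => ⟨hT m, (hjump m).trans hηδ⟩, ?_⟩
  have h1 := hsum (N + 1)
  have h2 := (abs_le.1 (h.oscillation _ _ (hxK (N + 1)) _ (hsK' (N + 1)))).2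
  push_cast at h1
  linarith

theorem exists_chain_of_sequence {φ : Flow ℝ X} {α : X → X → ℝ} {C : Set X} {s T : ℝ} {N : ℕ}
    {x : ℕ → X} {τ : ℕ → ℝ} (hN : 0 < N) (hτ : ∀ m, T ≤ τ m)
    (hball : ∀ m, ∃ c ∈ C, φ (τ m) (x m) ∈ Metric.ball c s ∧ x (m + 1) ∈ Metric.ball c s) :
    ∃ γ : Chain X, γ.IsChain φ C s T ∧ γ.integral φ α = ∑ m ∈ Finset.range N,
      (trajectoryIntegral φ α (x m) 0 (τ m) + α (φ (τ m) (x m)) (x (m + 1))) := by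
  refine ⟨⟨N, fun k => x k, fun k => τ k⟩, ⟨hN, fun k => ⟨hτ k, hball k⟩⟩, ?_⟩
  rw [Finset.sum_range]
  rfl

theorem IsBallCovering.exists_lebesgue_number [CompactSpace X] {C : Set X} {s : ℝ}
    (hC : IsBallCovering C s) :
    ∃ δ > 0, ∀ x y, dist x y < δ → ∃ c ∈ C, x ∈ Metric.ball c s ∧ y ∈ Metric.ball c s := by
  obtain ⟨δ, hδ, h⟩ := lebesgue_number_lemma_of_metric (isCompact_univ (X := X))
    (c := fun c : C => Metric.ball (c : X) s) (fun _ => Metric.isOpen_ball)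
    (by rw [← biUnion_eq_iUnion C fun c _ => Metric.ball c s]; exact hC.ge)
  refine ⟨δ, hδ, fun x y hxy => ?_⟩
  obtain ⟨c, hc⟩ := h x (mem_univ x)
  exact ⟨c, c.2, hc (Metric.mem_ball_self hδ), hc (Metric.mem_ball'.2 hxy)⟩

end Connections

/-- An `α`-flow which is not gradient-like has chains with arbitrarily large integrals. -/
theorem IsAlphaFlow.exists_large_chain {X : Type*} [MetricSpace X] [CompactSpace X]
    {φ : Flow ℝ X} {α : X → X → ℝ} (hφ : IsAlphaFlow φ α) (hgrad : ¬ IsGradientLike φ)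
    {C : Set X} {s : ℝ} (hC : IsBallCovering C s) (M T : ℝ) :
    ∃ γ : Chain X, γ.IsChain φ C s T ∧ M ≤ γ.integral φ α := by
  obtain ⟨n, p, hp⟩ := hφ
  obtain ⟨V, r, T₀, ρ, lam, hV, hVd, hr, hrV, hT₀, hρ, -, hlam1, hβ, hb, hub⟩ := hp.carries
  choose β hβ hosc using hβ
  obtain ⟨δ, hδ, hleb⟩ := hC.exists_lebesgue_number
  let K : Fin n → Set X := fun i => flowNeighborhood φ {p i} (V i) r
  have hKV : ∀ i, K i ⊆ V i := fun i => flowNeighborhood_subset φ _ _ r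
  have hK : IsCarriedBy φ α K β T₀ ρ lam :=
    { cocycle := hp.cocycle
      isClosed := fun i => isClosed_flowNeighborhood φ (hV i) hr
      disjoint := fun i j hij => (hVd hij).mono (hKV i) (hKV j)
      time_pos := hT₀
      gain_pos := hρ
      lam_lt_one := hlam1
      primitive := hβ
      oscillation := hosc
      bounded := hb
      unbounded := hub }
  have hpK : ∀ i, K i ∈ 𝓝 (p i) := fun i =>
    mem_of_superset (Metric.closedBall_mem_nhds _ hr) fun x hx =>
      mem_flowNeighborhood_of_dist_le φ (hrV i) hx
  have hfix : ∀ i, p i ∈ fixedPointSet φ := by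
    intro i t
    have hmem : p i ∈ invariantPart φ (V i) := by rw [(hV i).2.2]; rfl
    have : φ t (p i) ∈ invariantPart φ (V i) := fun u => by
      rw [← φ.map_add]
      exact hmem _
    rwa [(hV i).2.2] at this
  -- An orbit inside the union of the disjoint closed sets `V i` stays in one of them by
  -- connectedness, hence is the isolated point.
  have hleave : ∀ x, (∀ i, x ≠ p i) → ∃ u, φ u x ∉ ⋃ i, V i := by
    intro x hx
    by_contra! hin
    obtain ⟨i, hi⟩ := mem_iUnion.1 (hin 0)
    have : x ∈ invariantPart φ (V i) := fun u =>
      mem_of_isPreconnected_of_mem (fun i => (hV i).1) hVd (continuous_orbit φ x)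
        isPreconnected_univ (fun u _ => hin u) (mem_univ 0) hi u (mem_univ u)
    rw [(hV i).2.2] at this
    exact hx i this
  by_contra! hsmall
  -- One piece of trajectory followed by a trivial jump to its own endpoint is a chain. The maximum
  -- with 0 ensures `a ≤ b`, as `T` may be negative here.
  have hbdd : ∀ x a b, max T 0 ≤ b - a → trajectoryIntegral φ α x a b < M := by
    intro x a b hab
    obtain ⟨γ, hγ, hγI⟩ := exists_chain_of_sequence (φ := φ) (α := α) (C := C) (s := s) (T := T)
      (N := 1) (x := fun m => φ (a + m * (b - a)) x) (τ := fun _ => b - a) one_pos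
      (fun _ => (le_max_left _ _).trans hab) fun m => by
        refine hleb _ _ ?_
        rw [← φ.map_add]
        simpa [add_mul, add_comm, add_left_comm] using hδ
    have := hsmall γ hγ
    rw [hγI] at this
    have hab' := (le_max_right T 0).trans hab
    simpa [← φ.map_add, hp.cocycle.self_eq_zero,
      trajectoryIntegral_shift hp.cocycle x a hab'] using this
  have hlim : ∀ x, ∃ i, Tendsto (fun t => φ t x) atTop (𝓝 (p i)) := by
    intro x
    obtain ⟨i, hi⟩ := hK.eventually_mem (x := x) fun a b _ => hbdd x a b
    refine ⟨i, tendsto_of_eventually_mem_isolating φ (hV i).1 (hV i).2.2 fun s => ?_⟩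
    exact ((tendsto_atTop_add_const_left _ s tendsto_id).eventually hi).mono fun t ht => hKV i ht
  choose ω hω using hlim
  refine hgrad (isGradientLike_of_not_chainReaches φ fun x hx => ?_)
  obtain ⟨u, hu⟩ := hleave x fun i hi => hx (hi ▸ hfix i)
  refine ⟨u, fun hrec => ?_⟩
  set z := φ u x
  have hnext : ∀ i, ChainReaches φ (p i) z → ∃ y, y ≠ p i ∧
      Tendsto (fun t => φ t y) atBot (𝓝 (p i)) ∧ ChainReaches φ (p (ω y)) z := by
    intro i hi
    obtain ⟨y, hyp, hy, hyz⟩ := exists_unstable_chainReaches φ (hV i) (hfix i)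
      (fun hz => hu (mem_iUnion_of_mem i hz)) hrec hi
    exact ⟨y, hyp, hy, chainReaches_of_tendsto φ hrec hyz (hfix _) (hω y)⟩
  have : Nonempty X := ⟨x⟩
  choose! Y hYp hYbot hYz using hnext
  -- From `p k`, the next fixed point is the forward limit of the chosen unstable point `Y k`.
  let i : ℕ → Fin n := fun m => (fun k => ω (Y k))^[m] (ω z)
  have hi_succ : ∀ m, i (m + 1) = ω (Y (i m)) := fun m => Function.iterate_succ_apply' _ _ _
  have hi : ∀ m, ChainReaches φ (p (i m)) z := by
    intro m
    induction m with
    | zero => exact chainReaches_of_tendsto φ hrec hrec (hfix _) (hω z)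
    | succ m ih => rw [hi_succ]; exact hYz _ ih
  obtain ⟨N, x', τ, hN, hstep, hM⟩ := hK.exists_large_chain hpK (i := i) (y := fun m => Y (i m))
    (fun m => hYbot _ (hi m)) (fun m => hi_succ m ▸ hω _) (fun m => by
      -- If `Y (i m)` were some `p k`, its constant orbit would have backward limit `p k = p (i m)`,
      -- against `hYp`.
      obtain ⟨v, hv⟩ := hleave (Y (i m)) (by
        intro k hk
        have hlimit := hYbot _ (hi m)
        simp only [hk, (hfix k) _] at hlimit
        exact hYp _ (hi m) (hk.trans (tendsto_nhds_unique tendsto_const_nhds hlimit)))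
      exact ⟨v, fun hvK => hv (iUnion_mono hKV hvK)⟩) hδ T M
  obtain ⟨γ, hγ, hγI⟩ := exists_chain_of_sequence (φ := φ) (α := α) (C := C) (s := s) hN
    (fun m => (hstep m).1) fun m => hleb _ _ (hstep m).2
  exact (hsmall γ hγ).not_ge (hγI ▸ hM)

end CocycleFlow

theorem theorem3p4 {X : Type*} [MetricSpace X] [CompactSpace X] (φ : Flow ℝ X) (α : X → X → ℝ)
    (hφ : CocycleFlow.IsAlphaFlow φ α) (hα : ¬ CocycleFlow.IsTrivialCocycle α)
    (hgrad : ¬ CocycleFlow.IsGradientLike φ)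
    (s : ℕ → ℝ) (hs : ∀ i, 0 < s i) (hs0 : Filter.Tendsto s Filter.atTop (nhds 0))
    (C : ℕ → Set X) (hC : ∀ i, CocycleFlow.IsBallCovering (C i) (s i))
    (M T : ℝ) (hM : 0 < M) (hT : 0 < T) (i : ℕ) :
    ∃ γ : CocycleFlow.Chain X, γ.IsChain φ (C i) (s i) T ∧ M ≤ |γ.integral φ α| := by
  obtain ⟨γ, hγ, hγM⟩ := hφ.exists_large_chain hgrad (hC i) M T
  exact ⟨γ, hγ, hγM.trans (le_abs_self _)⟩
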